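/- **Setting.** All logarithms $\log$ are to base $2$. $\mathcal H_E$ is any finite-dimensional Hilbert space. For a (sub-)normalized state $\rho_{XE}$, $H_{\min}(X|E)_\rho$ is the supremum of the real $\lambda$ such that $2^{-\lambda}\,\mathbb 1_X\otimes\sigma_E\ge\rho_{XE}$ for some normalized state $\sigma_E$. A function $\mathrm{Ext}:\{0,1\}^n\times\{0,1\}^d\to\{0,1\}^m$ is a *quantum-proof $(k,\varepsilon)$-strong extractor with uniform seed* if, for all states $\rho_{XE}$ classical on $X\in\{0,1\}^n$ with $H_{\min}(X|E)_\rho\ge k$ and for $Y$ uniform on $\{0,1\}^d$ and independent of $XE$, $$\tfrac12\bigl\|\rho_{\mathrm{Ext}(X,Y)YE}-\rho_{U_m}\otimes\rho_Y\otimes\rho_E\bigr\|_{\mathrm{tr}}\le\varepsilon ,$$ where $\rho_{U_m}$ is the fully mixed state of dimension $2^m$. Sets $S_1,\dots,S_m\subseteq[d]$ form a *weak $(t,r)$-design* if $|S_i|=t$ and $\sum_{j<i}2^{|S_j\cap S_i|}\le rm$ for all $i$. A *family of code-based one-bit extractors* consists of functions $C_{n,\delta}:\{0,1\}^n\times\{0,1\}^t\to\{0,1\}$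 for $n\ge1$ and $0<\delta\le1$, with $C_{n,\delta}(x,y)=c_{n,\delta}(x)_y$, where $c_{n,\delta}:\{0,1\}^n\to\{0,1\}^{2^t}$ is a $(\delta/2,4/\delta^2)$-list-decodable code (every Hamming ball of relative radius $1/2-\delta/2$ contains the codewords of at most $4/\delta^2$ messages), and $t=t(n,\delta)\le K\log(n/\delta)$ for a constant $K$. **Statement.** Families of code-based one-bit extractors exist. There is an absolute constant $c_0$ such that the following holds for every such family. Let $a>0$ and $0<\gamma<\alpha\le1$, and let $n\ge2$, $m\ge1$ and $n^{-a}\le\varepsilon\le1$. Put $\delta=\varepsilon^2/(9m^2)$, $t=t(n,\delta)$, $r=n^\gamma$, $d=t\lceil t/\ln r\rceil$ and $$k=n^\gamma m+8\log m+8\log\tfrac1\varepsilon+c_0 .$$ 1. There is a weak $(t,r)$-design $S_1,\dots,S_m\subseteq[d]$. 2. For every such design, the function $\mathrm{Ext}(x,y)=C_{n,\delta}(x,y_{S_1})\cdots C_{n,\delta}(x,y_{S_m})$, from $\{0,1\}^n\times\{0,1\}^d$ to $\{0,1\}^m$, is a quantum-proof $(k,\varepsilon)$-strong extractor with uniform seed.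 3. If $m\le n^{\alpha-\gamma}$, then $d\le D\cdot\frac1\gamma\log n$, where $D$ depends only on $a$ and the family. 4. There are numbers $\eta_n\to0$, depending only on $a,\alpha,\gamma$ and the family, such that $m\le n^{\alpha-\gamma}-\eta_n$ implies $k\le n^\alpha$, so that $\mathrm{Ext}$ is a quantum-proof $(n^\alpha,\varepsilon)$-strong extractor: from every source with $H_{\min}(X|E)\ge n^\alpha$ it extracts $m=\lfloor n^{\alpha-\gamma}-\eta_n\rfloor$ bits, whenever this number is at least $1$. -/

import Mathlib

open scoped ComplexOrder MatrixOrder Kronecker Topology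

noncomputable section

namespace QuantumExtractor

/-- Bit strings of length `n`. -/
abbrev Bits (n : ℕ) : Type := Fin n → Bool

/-! ### Quantum states and conditional min-entropy

Finite-dimensional Hilbert spaces are `ℂ^A` with `A` a finite type; operators on `ℂ^A ⊗ ℂ^B` are
matrices indexed by `A × B`. -/

section States

variable {A B : Type} [Fintype A] [DecidableEq A] [Fintype B] [DecidableEq B]

/-- Normalized states: positive semidefinite with trace one. -/
def IsNormalizedState (σ : Matrix A A ℂ) : Prop :=
  σ.PosSemidef ∧ σ.trace = 1

/-- Sub-normalized states: positive semidefinite with trace at most one. -/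
def IsSubnormalizedState (ρ : Matrix A A ℂ) : Prop :=
  ρ.PosSemidef ∧ ρ.trace ≤ 1

/-- The trace norm `tr √(M† M)`. -/
def traceNorm (M : Matrix A A ℂ) : ℝ :=
  (CFC.sqrt (M.conjTranspose * M)).trace.re

/-- The conditional min-entropy `H_min(A|B)_ρ`: the supremum (a maximum unless `ρ = 0`) of the real
`l` such that `2^{-l} 1_A ⊗ σ_B ≥ ρ_{AB}` in the Loewner order for some normalized state `σ_B`.
It is extended-real valued, since it is `⊤` for `ρ = 0`. -/
def minEntropy (ρ : Matrix (A × B) (A × B) ℂ) : EReal :=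
  sSup ((fun l : ℝ => (l : EReal)) '' {l : ℝ | ∃ σ : Matrix B B ℂ, IsNormalizedState σ ∧
    ρ ≤ ((2 : ℝ) ^ (-l)) • ((1 : Matrix A A ℂ) ⊗ₖ σ)})

/-- The diagonal block of `ρ_{AB}` at `a`. For a state classical on `A` this is
`p_a ρ_B^a`, the state of `B` weighted by the probability of `a`. -/
def block (ρ : Matrix (A × B) (A × B) ℂ) (a : A) : Matrix B B ℂ :=
  Matrix.of fun b b' => ρ (a, b) (a, b')

/-- `ρ_{AB}` is classical on `A`: `ρ_{AB} = ∑ a, |a⟩⟨a| ⊗ (p_a ρ_B^a)`. -/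
def IsClassicalOnFirst (ρ : Matrix (A × B) (A × B) ℂ) : Prop :=
  ρ = ∑ a, Matrix.single a a (1 : ℂ) ⊗ₖ block ρ a

/-- The reduced operator `ρ_B = tr_A ρ_{AB}`. -/
def reduceToSecond (ρ : Matrix (A × B) (A × B) ℂ) : Matrix B B ℂ :=
  ∑ a, block ρ a

/-- The fully mixed state. -/
def fullyMixed (A : Type) [Fintype A] [DecidableEq A] : Matrix A A ℂ :=
  ((Fintype.card A : ℂ)⁻¹) • 1

end States

/-! ### Quantum-proof strong extractors -/

/-- The state `ρ_{Ext(X,Y) Y E}`, for a seed `Y` that is uniform and independent of `XE`. -/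
def outputState {n d m : ℕ} (Ext : Bits n → Bits d → Bits m)
    {E : Type} [Fintype E] [DecidableEq E] (ρ : Matrix (Bits n × E) (Bits n × E) ℂ) :
    Matrix ((Bits m × Bits d) × E) ((Bits m × Bits d) × E) ℂ :=
  ∑ x : Bits n, ∑ y : Bits d, (((2 : ℂ) ^ d)⁻¹) •
    ((Matrix.single (Ext x y) (Ext x y) (1 : ℂ) ⊗ₖ Matrix.single y y (1 : ℂ)) ⊗ₖ block ρ x)

/-- The ideal state `ρ_{U_m} ⊗ ρ_Y ⊗ ρ_E`, with `Y` uniform. -/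
def idealState {n : ℕ} (d m : ℕ) {E : Type} [Fintype E] [DecidableEq E]
    (ρ : Matrix (Bits n × E) (Bits n × E) ℂ) :
    Matrix ((Bits m × Bits d) × E) ((Bits m × Bits d) × E) ℂ :=
  (fullyMixed (Bits m) ⊗ₖ fullyMixed (Bits d)) ⊗ₖ reduceToSecond ρ

/-- `Ext` is a quantum-proof `(k, ε)`-strong extractor with uniform seed. -/
def IsQuantumProofStrongExtractor {n d m : ℕ} (Ext : Bits n → Bits d → Bits m) (k ε : ℝ) : Prop :=
  ∀ (E : Type) [Fintype E] [DecidableEq E] (ρ : Matrix (Bits n × E) (Bits n × E) ℂ),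
    IsSubnormalizedState ρ → IsClassicalOnFirst ρ → (k : EReal) ≤ minEntropy ρ →
      1 / 2 * traceNorm (outputState Ext ρ - idealState d m ρ) ≤ ε

/-! ### Weak designs and Trevisan's construction -/

/-- `S_1, …, S_m ⊆ [d]` form a weak `(t, r)`-design. -/
def IsWeakDesign {m d : ℕ} (t : ℕ) (r : ℝ) (S : Fin m → Finset (Fin d)) : Prop :=
  (∀ i, (S i).card = t) ∧
    ∀ i, ∑ j ∈ Finset.univ.filter (fun j => j < i), (2 : ℝ) ^ (S j ∩ S i).card ≤ r * m

/-- The substring `y_S` of the bits of `y` at the positions in `S`, in increasing order. -/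
def restrict {d t : ℕ} (y : Bits d) (S : Finset (Fin d)) (hS : S.card = t) : Bits t :=
  fun l => y (S.orderEmbOfFin hS l)

/-- Trevisan's extractor `Ext_C(x, y) = C(x, y_{S_1}) ⋯ C(x, y_{S_m})`. -/
def trevisan {n t d m : ℕ} (C : Bits n → Bits t → Bool) (S : Fin m → Finset (Fin d))
    (hS : ∀ i, (S i).card = t) : Bits n → Bits d → Bits m :=
  fun x y i => C x (restrict y (S i) (hS i))

/-- The size `d = t ⌈t / ln r⌉` of the ground set of the weak `(t, r)`-designs of
Raz, Reingold and Vadhan, for `r > 1`. -/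
def rrvSeedLength (t : ℕ) (r : ℝ) : ℕ :=
  t * ⌈(t : ℝ) / Real.log r⌉₊

/-! ### One-bit extractors from list-decodable codes -/

/-- The code `C` with codewords indexed by `ι` is `(ε, L)`-list-decodable: every Hamming ball of
relative radius `1/2 - ε` contains the codewords of at most `L` messages. -/
def IsListDecodable {n : ℕ} {ι : Type} [Fintype ι] (C : Bits n → ι → Bool) (ε L : ℝ) : Prop :=
  ∀ w : ι → Bool,
    (((Finset.univ.filter fun x : Bits n =>
      (hammingDist (C x) w : ℝ) ≤ (1 / 2 - ε) * Fintype.card ι).card : ℕ) : ℝ) ≤ L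

/-- A family of code-based one-bit extractors `C_{n,δ} : {0,1}^n × {0,1}^t → {0,1}`,
`C_{n,δ}(x, y) = c_{n,δ}(x)_y`, where `c_{n,δ}` is a `(δ/2, 1/(δ/2)^2)`-list-decodable code of
length `2^t`, its positions being named by the strings `y` of length `t`,
and where `t = t n δ ≤ K log₂ (n/δ)`. -/
def IsCodeExtractorFamily (K : ℝ) (t : ℕ → ℝ → ℕ)
    (C : (n : ℕ) → (δ : ℝ) → Bits n → Bits (t n δ) → Bool) : Prop :=
  ∀ n : ℕ, 1 ≤ n → ∀ δ : ℝ, 0 < δ → δ ≤ 1 →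
    IsListDecodable (C n δ) (δ / 2) (1 / (δ / 2) ^ 2) ∧
      (t n δ : ℝ) ≤ K * Real.logb 2 (n / δ)

end QuantumExtractor

end

open QuantumExtractor

/-! The distance from the ideal state is the advantage of a distinguisher holding the output, the
seed and `E` (`exists_distinguisher`). A hybrid argument splits it into `m` advantages, each for
guessing the `i`-th output bit from the earlier bits, the seed and `E`
(`sub_average_eq_sum_hybrid`). Once the seed bits outside `S i` are fixed, the earlier bits are read
off from tables indexed by the overlaps `S j ∩ S i`. The weak design allows at most `2 ^ (r m)` such
tables, so knowing them costs at most `r m` bits of min-entropy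
(`IsWeakDesign.card_sharedTables_le`).

It remains to see that a list-decodable code is a one-bit extractor against quantum side information
(`two_sum_sign_trace_le`). Let `D v = ∑ x, s x v • ρ x` be the difference of the states for bit 0
and bit 1 at position `v`, and let `τ` be a slight perturbation of `∑ x, ρ x`. A Cauchy–Schwarz
inequality weighted by `τ` removes the unknown test and leaves `tr (τ^{-1/2} D v τ^{-1/2} D v)`.
Summed over `v`, this is a sum over pairs `x, z` of the correlation of their codewords times `tr (W
z ρ x)`, where `W z = τ^{-1/2} ρ z τ^{-1/2}` is a pretty good measurement. Relative to the code
length, weakly correlated pairs contribute at most `δ`. List decoding leaves at most `L` other `x`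
for each `z`, and `ρ x ≤ c σ` bounds their total by `L c`.

The codes are Reed–Solomon codes concatenated with Hadamard codes, list-decodable by a Johnson
bound. The designs are chosen greedily among transversals of `t` blocks. -/

namespace QuantumExtractor

set_option linter.unusedSectionVars false

/-! ### Trace inequalities and the optimal test -/

section MatrixLemmas

open Matrix

variable {E : Type} [Fintype E] [DecidableEq E]

lemma trace_re_nonneg {A : Matrix E E ℂ} (hA : A.PosSemidef) : 0 ≤ A.trace.re :=
  (Complex.le_def.1 hA.trace_nonneg).1

lemma trace_re_mono {A B : Matrix E E ℂ} (h : A ≤ B) : A.trace.re ≤ B.trace.re := by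
  have := trace_re_nonneg (Matrix.le_iff.1 h)
  rw [trace_sub, Complex.sub_re] at this
  linarith

lemma trace_mul_re_nonneg {A B : Matrix E E ℂ} (hA : A.PosSemidef) (hB : B.PosSemidef) :
    0 ≤ (A * B).trace.re := by
  obtain ⟨C, rfl⟩ : ∃ C : Matrix E E ℂ, A = Cᴴ * C := by
    have h0 : 0 ≤ A := nonneg_iff_posSemidef.2 hA
    have hs : (CFC.sqrt A).PosSemidef := nonneg_iff_posSemidef.1 (CFC.sqrt_nonneg A)
    exact ⟨CFC.sqrt A, by rw [hs.1.eq, CFC.sqrt_mul_sqrt_self A h0]⟩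
  rw [Matrix.mul_assoc, Matrix.trace_mul_comm]
  exact trace_re_nonneg (hB.mul_mul_conjTranspose_same C)

lemma trace_mul_re_mono {A B C : Matrix E E ℂ} (hA : A.PosSemidef) (h : B ≤ C) :
    (A * B).trace.re ≤ (A * C).trace.re := by
  have := trace_mul_re_nonneg hA (Matrix.le_iff.1 h)
  rw [Matrix.mul_sub, trace_sub, Complex.sub_re] at this
  linarith

/-- Since all factors commute, `2 (1 - Q²)` is `(1-Q)(1+Q)(1-Q) + (1+Q)(1-Q)(1+Q)`, a sum of
conjugates of positive matrices. -/
lemma one_sub_mul_self_posSemidef {Q : Matrix E E ℂ} (h1 : (1 - Q).PosSemidef)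
    (h2 : (1 + Q).PosSemidef) : (1 - Q * Q).PosSemidef := by
  have e : 1 - Q * Q = (1 / 2 : ℝ) • ((1 - Q) * (1 + Q) * (1 - Q)ᴴ + (1 + Q) * (1 - Q) * (1 + Q)ᴴ) := by
    rw [h1.1.eq, h2.1.eq]
    have : (1 - Q) * (1 + Q) * (1 - Q) + (1 + Q) * (1 - Q) * (1 + Q) = (2 : ℝ) • (1 - Q * Q) := by
      rw [two_smul]; noncomm_ring
    rw [this, smul_smul]; norm_num
  rw [e]
  exact ((h2.mul_mul_conjTranspose_same _).add (h1.mul_mul_conjTranspose_same _)).smul (by norm_num)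

/-- A fourth root lets Cauchy–Schwarz be applied to the Hermitian matrices `R Q R` and `N D N`,
whose product still has trace `tr (Q D)`. -/
lemma exists_fourth_root {τ : Matrix E E ℂ} (hτ : τ.PosDef) :
    ∃ R N : Matrix E E ℂ, R.IsHermitian ∧ N.IsHermitian ∧ R * N = 1 ∧ N * R = 1 ∧
      R * R * (R * R) = τ := by
  have h0 : 0 ≤ τ := nonneg_iff_posSemidef.2 hτ.posSemidef
  have h1 : 0 ≤ CFC.sqrt τ := CFC.sqrt_nonneg τ
  have h2 : 0 ≤ CFC.sqrt (CFC.sqrt τ) := CFC.sqrt_nonneg _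
  set R := CFC.sqrt (CFC.sqrt τ) with hR
  have e : R * R * (R * R) = τ := by
    rw [hR, CFC.sqrt_mul_sqrt_self _ h1, CFC.sqrt_mul_sqrt_self _ h0]
  have hu : IsUnit R := by
    have : IsUnit (R ^ 4) := by
      have e4 : R ^ 4 = τ := by rw [← e]; noncomm_ring
      rw [e4]; exact hτ.isUnit
    exact (isUnit_pow_iff (by norm_num)).1 this
  have hd := (Matrix.isUnit_iff_isUnit_det _).1 hu
  have hH : R.IsHermitian := (nonneg_iff_posSemidef.1 h2).1
  exact ⟨R, R⁻¹, hH, hH.inv, mul_nonsing_inv _ hd, nonsing_inv_mul _ hd, e⟩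

lemma two_trace_mul_re_le {A B : Matrix E E ℂ} (hA : A.IsHermitian) (hB : B.IsHermitian)
    {l : ℝ} (hl : 0 < l) :
    2 * (A * B).trace.re ≤ l * (A * A).trace.re + l⁻¹ * (B * B).trace.re := by
  have h := trace_re_nonneg (posSemidef_conjTranspose_mul_self (l • A - B))
  have e : (l • A - B)ᴴ = l • A - B := by
    rw [conjTranspose_sub, conjTranspose_smul, hA.eq, hB.eq]; simp
  rw [e] at h
  have e2 : ((l • A - B) * (l • A - B)).trace.re =
      l * l * (A * A).trace.re - 2 * l * (A * B).trace.re + (B * B).trace.re := by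
    simp only [Matrix.sub_mul, Matrix.mul_sub, trace_sub, Matrix.smul_mul, Matrix.mul_smul,
      trace_smul, Complex.sub_re, Complex.smul_re, smul_eq_mul, trace_mul_comm B A]
    ring
  rw [e2] at h
  have h3 : l * (l * (A * A).trace.re + l⁻¹ * (B * B).trace.re - 2 * (A * B).trace.re) =
      l * l * (A * A).trace.re - 2 * l * (A * B).trace.re + (B * B).trace.re := by
    field_simp; ring
  rw [← h3] at h
  have := nonneg_of_mul_nonneg_right h hl
  linarith

lemma trace_mul_self_re_le {Z : Matrix E E ℂ} : (Z * Z).trace.re ≤ (Zᴴ * Z).trace.re := by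
  have h := trace_re_nonneg (posSemidef_conjTranspose_mul_self (Z - Zᴴ))
  have e1 : (Zᴴ * Zᴴ).trace.re = (Z * Z).trace.re := by
    rw [← conjTranspose_mul, trace_conjTranspose]; simp
  simp only [conjTranspose_sub, conjTranspose_conjTranspose, Matrix.sub_mul, Matrix.mul_sub,
    trace_sub, Complex.sub_re, e1, trace_mul_comm Z Zᴴ] at h
  linarith

/-- A weighted Cauchy–Schwarz inequality with respect to the inner product
`(X, Y) ↦ tr (τ^{-1/2} X† τ^{-1/2} Y)`, where `τ = R ^ 4` and `N = R⁻¹`. -/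
lemma two_trace_contraction_mul_re_le {Q D R N τ : Matrix E E ℂ} (h1 : (1 - Q).PosSemidef)
    (h2 : (1 + Q).PosSemidef) (hD : D.IsHermitian) (hR : R.IsHermitian) (hN : N.IsHermitian)
    (hRN : R * N = 1) (hNR : N * R = 1) (hτ : R * R * (R * R) = τ) {l : ℝ} (hl : 0 < l) :
    2 * (Q * D).trace.re ≤ l * τ.trace.re + l⁻¹ * (N * N * D * (N * N) * D).trace.re := by
  have hQ : Q.IsHermitian := by
    have := h2.1.sub (isHermitian_one (n := E) (α := ℂ))
    simpa using this
  have hA : (R * Q * R).IsHermitian := by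
    have := isHermitian_conjTranspose_mul_mul R hQ
    rwa [hR.eq] at this
  have hB : (N * D * N).IsHermitian := by
    have := isHermitian_conjTranspose_mul_mul N hD
    rwa [hN.eq] at this
  have h := two_trace_mul_re_le hA hB hl
  have eAB : (R * Q * R * (N * D * N)).trace = (Q * D).trace := by
    rw [show R * Q * R * (N * D * N) = R * Q * (R * N) * D * N by noncomm_ring, hRN,
      Matrix.mul_one, trace_mul_comm, show N * (R * Q * D) = N * R * (Q * D) by noncomm_ring, hNR,
      Matrix.one_mul]
  have eBB : (N * D * N * (N * D * N)).trace = (N * N * D * (N * N) * D).trace := by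
    rw [trace_mul_comm, show N * D * N * (N * D * N) = N * D * (N * N) * D * N by noncomm_ring,
      trace_mul_comm]
    congr 1; noncomm_ring
  -- With `Z = Q R²`, the left side is `tr (Z Z) ≤ tr (Z† Z) = tr (R² Q² R²)`, and `Q² ≤ 1`
  -- finishes.
  have hAA : (R * Q * R * (R * Q * R)).trace.re ≤ τ.trace.re := by
    have hS : (R * R)ᴴ = R * R := by rw [conjTranspose_mul, hR.eq]
    have e : (R * Q * R * (R * Q * R)).trace = (Q * (R * R) * (Q * (R * R))).trace := by
      rw [show R * Q * R * (R * Q * R) = R * (Q * (R * R) * Q * R) by noncomm_ring,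
        trace_mul_comm]
      congr 1; noncomm_ring
    rw [e]
    refine trace_mul_self_re_le.trans ?_
    rw [conjTranspose_mul, hQ.eq, hS, ← hτ]
    apply trace_re_mono
    rw [Matrix.le_iff]
    have := (one_sub_mul_self_posSemidef h1 h2).mul_mul_conjTranspose_same (R * R)
    rw [hS] at this
    have e2 : R * R * (R * R) - R * R * Q * (Q * (R * R)) = R * R * (1 - Q * Q) * (R * R) := by
      noncomm_ring
    rwa [e2]
  rw [eAB, eBB] at h
  have := mul_le_mul_of_nonneg_left hAA hl.le
  linarith

/-- The Helstrom test: the trace norm of a traceless Hermitian matrix is twice its largest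
expectation over tests `0 ≤ P ≤ 1`. -/
lemma exists_test_of_isHermitian {M : Matrix E E ℂ} (hM : M.IsHermitian) (ht : M.trace = 0) :
    ∃ P : Matrix E E ℂ, P.PosSemidef ∧ (1 - P).PosSemidef ∧
      1 / 2 * traceNorm M = (P * M).trace.re := by
  have hsa : IsSelfAdjoint M := hM
  have hc : ∀ f : ℝ → ℝ, ContinuousOn f (spectrum ℝ M) := fun f =>
    (Matrix.finite_real_spectrum (A := M)).continuousOn f
  set f : ℝ → ℝ := fun x => if 0 < x then 1 else 0 with hf
  refine ⟨cfc f M, ?_, ?_, ?_⟩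
  · rw [← nonneg_iff_posSemidef]
    exact cfc_nonneg fun x _ => by simp only [hf]; split_ifs <;> norm_num
  · rw [← nonneg_iff_posSemidef, sub_nonneg]
    exact cfc_le_one f M fun x _ => by simp only [hf]; split_ifs <;> norm_num
  · have habs : CFC.sqrt (Mᴴ * M) = cfc (fun x : ℝ => ‖x‖) M := CFC.abs_eq_cfc_norm M
    -- `|x| = 2 · 1_{x > 0} · x - x`; the last term disappears under the trace because `M` is
    -- traceless.
    have e : cfc (fun x : ℝ => ‖x‖) M = (2 : ℝ) • (cfc f M * M) - M := by
      have h1 : cfc f M * M = cfc (fun x => f x * x) M := by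
        rw [cfc_mul f (fun x => x) M (hc _) (hc _), cfc_id' ℝ M]
      have h2 : cfc (fun x : ℝ => 2 • (f x * x) - x) M = 2 • cfc (fun x => f x * x) M - M := by
        rw [cfc_sub (fun x => 2 • (f x * x)) (fun x => x) M (hc _) (hc _), cfc_id' ℝ M,
          cfc_smul (2 : ℕ) _ M (hc _)]
      rw [h1, show ((2 : ℝ) • cfc (fun x => f x * x) M) = 2 • cfc (fun x => f x * x) M by
        rw [two_smul, two_smul], ← h2]
      congr 1
      funext x
      simp only [hf, Real.norm_eq_abs]
      split_ifs with h
      · rw [abs_of_pos h]; simp; ring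
      · rw [abs_of_nonpos (not_lt.1 h)]; simp
    rw [traceNorm, habs, e, trace_sub, ht, trace_smul]
    simp
end MatrixLemmas

/-! ### Distinguishers for classical-quantum states -/

section Tests

open Matrix

variable {A E : Type} [Fintype A] [DecidableEq A] [Fintype E] [DecidableEq E]

lemma block_posSemidef {ρ : Matrix (A × E) (A × E) ℂ} (hρ : ρ.PosSemidef) (a : A) :
    (block ρ a).PosSemidef :=
  hρ.submatrix (fun e => (a, e))

lemma block_mono {ρ ρ' : Matrix (A × E) (A × E) ℂ} (h : ρ ≤ ρ') (a : A) :
    block ρ a ≤ block ρ' a :=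
  block_posSemidef (Matrix.le_iff.1 h) a

lemma trace_mul_single_kronecker (P : Matrix (A × E) (A × E) ℂ) (a : A) (M : Matrix E E ℂ) :
    (P * (Matrix.single a a (1 : ℂ) ⊗ₖ M)).trace = (block P a * M).trace := by
  simp only [trace, diag, mul_apply, kroneckerMap_apply, block, of_apply, Fintype.sum_prod_type]
  rw [Finset.sum_eq_single a]
  · refine Finset.sum_congr rfl fun e _ => ?_
    rw [Finset.sum_eq_single a]
    · simp
    · intro b _ hb; simp [hb.symm]
    · simp
  · intro b _ hb; simp [hb.symm]
  · simp

lemma one_kronecker_eq_sum (M : Matrix E E ℂ) :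
    (1 : Matrix A A ℂ) ⊗ₖ M = ∑ a, Matrix.single a a (1 : ℂ) ⊗ₖ M := by
  ext ⟨a, e⟩ ⟨b, e'⟩
  simp only [kroneckerMap_apply, Matrix.sum_apply, Matrix.one_apply, Matrix.single_apply]
  by_cases h : a = b
  · subst h; simp
  · rw [if_neg h, Finset.sum_eq_zero]
    · simp
    · intro c _
      rw [if_neg]
      · simp
      · rintro ⟨rfl, rfl⟩; exact h rfl

lemma trace_reduceToSecond (ρ : Matrix (A × E) (A × E) ℂ) :
    (reduceToSecond ρ).trace = ρ.trace := by
  simp [reduceToSecond, trace, block, Fintype.sum_prod_type, Matrix.sum_apply]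
  rw [Finset.sum_comm]

variable {n d m : ℕ}

lemma outputState_eq (Ext : Bits n → Bits d → Bits m) (ρ : Matrix (Bits n × E) (Bits n × E) ℂ) :
    outputState Ext ρ = ((2 : ℝ) ^ d)⁻¹ • ∑ x, ∑ y,
      Matrix.single (Ext x y, y) (Ext x y, y) (1 : ℂ) ⊗ₖ block ρ x := by
  simp only [outputState, Finset.smul_sum, single_kronecker_single, mul_one]
  refine Finset.sum_congr rfl fun x _ => Finset.sum_congr rfl fun y _ => ?_
  ext i j
  simp [Complex.real_smul]

lemma idealState_eq (ρ : Matrix (Bits n × E) (Bits n × E) ℂ) :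
    idealState d m ρ = ((2 : ℝ) ^ d)⁻¹ • ∑ x, ∑ y : Bits d, ((2 : ℝ) ^ m)⁻¹ • ∑ w : Bits m,
      Matrix.single (w, y) (w, y) (1 : ℂ) ⊗ₖ block ρ x := by
  have h : ∑ x, ∑ y : Bits d, ((2 : ℝ) ^ m)⁻¹ • ∑ w : Bits m,
      Matrix.single (w, y) (w, y) (1 : ℂ) ⊗ₖ block ρ x =
      ((2 : ℝ) ^ m)⁻¹ • ((1 : Matrix (Bits m × Bits d) (Bits m × Bits d) ℂ) ⊗ₖ
        reduceToSecond ρ) := by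
    have : (1 : Matrix (Bits m × Bits d) (Bits m × Bits d) ℂ) ⊗ₖ reduceToSecond ρ =
        ∑ x, (1 : Matrix (Bits m × Bits d) (Bits m × Bits d) ℂ) ⊗ₖ block ρ x := by
      ext i j
      simp [reduceToSecond, Matrix.sum_apply, Finset.mul_sum]
    rw [this, Finset.smul_sum]
    refine Finset.sum_congr rfl fun x _ => ?_
    rw [one_kronecker_eq_sum, Fintype.sum_prod_type_right, Finset.smul_sum]
  rw [h]
  ext i j
  simp [idealState, fullyMixed, Complex.real_smul, Matrix.smul_kronecker, Matrix.kronecker_smul]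
  ring

/-- The distance of the output of an extractor from the ideal state is the advantage of a
distinguisher, given by tests `P w y` of the side information that depend on the output `w` and
the seed `y`. -/
lemma exists_distinguisher (Ext : Bits n → Bits d → Bits m)
    {ρ : Matrix (Bits n × E) (Bits n × E) ℂ} (hρ : ρ.PosSemidef) :
    ∃ P : Bits m → Bits d → Matrix E E ℂ,
      (∀ w y, (P w y).PosSemidef) ∧ (∀ w y, (1 - P w y).PosSemidef) ∧
      1 / 2 * traceNorm (outputState Ext ρ - idealState d m ρ) =
        ((2 : ℝ) ^ d)⁻¹ * ∑ x, ∑ y, ((P (Ext x y) y * block ρ x).trace.re -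
          ((2 : ℝ) ^ m)⁻¹ * ∑ w, (P w y * block ρ x).trace.re) := by
  have hb := fun x => (block_posSemidef hρ x).1
  have hsum : ∀ (P : Matrix ((Bits m × Bits d) × E) ((Bits m × Bits d) × E) ℂ),
      (P * (outputState Ext ρ - idealState d m ρ)).trace.re =
      ((2 : ℝ) ^ d)⁻¹ * ∑ x, ∑ y, ((block P (Ext x y, y) * block ρ x).trace.re -
          ((2 : ℝ) ^ m)⁻¹ * ∑ w, (block P (w, y) * block ρ x).trace.re) := by
    intro P
    rw [outputState_eq, idealState_eq]
    simp only [Matrix.mul_smul, Matrix.mul_sum, trace_sub, trace_smul, trace_sum,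
      trace_mul_single_kronecker, Complex.sub_re, Complex.smul_re, Complex.re_sum, smul_eq_mul,
      Finset.sum_sub_distrib, mul_sub]
  have hs : ∀ a : Bits m × Bits d, ∀ x,
      (Matrix.single a a (1 : ℂ) ⊗ₖ block ρ x).IsHermitian := by
    intro a x
    rw [IsHermitian, conjTranspose_kronecker, (hb x).eq]
    simp
  have hH : (outputState Ext ρ - idealState d m ρ).IsHermitian := by
    rw [outputState_eq, idealState_eq, IsHermitian]
    simp only [conjTranspose_sub, conjTranspose_smul, conjTranspose_sum, (hs _ _).eq, star_trivial]
  have ht : (outputState Ext ρ - idealState d m ρ).trace = 0 := by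
    rw [outputState_eq, idealState_eq]
    simp only [trace_sub, trace_smul, trace_sum, trace_kronecker, trace_single_eq_same, one_mul]
    simp
  obtain ⟨P, hP, hP1, e⟩ := exists_test_of_isHermitian hH ht
  refine ⟨fun w y => block P (w, y), fun w y => block_posSemidef hP _, fun w y => ?_, ?_⟩
  · have := block_posSemidef hP1 (w, y)
    convert this using 1
    ext e e'
    simp [block, Matrix.one_apply]
  · rw [e, hsum]

end Tests

/-! ### One-bit extraction against quantum side information -/

section OneBit

open Matrix

variable {X V G E : Type} [Fintype X] [Fintype V] [Fintype G] [DecidableEq G]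
  [Fintype E] [DecidableEq E]

/-- If every `z` has at most `L` vectors `s x` whose correlation with `s z` exceeds `δ`, then the
family `s` is unpredictable from quantum side information of high min-entropy. -/
lemma two_sum_sign_trace_le (s : X → V → ℝ) (hs : ∀ x v, |s x v| ≤ 1) {ρ : X → Matrix E E ℂ}
    (hρ : ∀ x, (ρ x).PosSemidef) {Q : V → Matrix E E ℂ} (h1 : ∀ v, (1 - Q v).PosSemidef)
    (h2 : ∀ v, (1 + Q v).PosSemidef) {σ : Matrix E E ℂ} (hσ1 : σ.trace.re ≤ 1) {c : ℝ}
    (hc0 : 0 ≤ c) (hc : ∀ x, ρ x ≤ c • σ) {δ L : ℝ} (hδ : 0 ≤ δ) (hL0 : 0 ≤ L)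
    (hL : ∀ z, ((Finset.univ.filter fun x => δ * Fintype.card V < ∑ v, s x v * s z v).card : ℝ)
      ≤ L) {η : ℝ} (hη : 0 < η) {l : ℝ} (hl : 0 < l) :
    2 * ∑ v, ∑ x, s x v * (Q v * ρ x).trace.re ≤ Fintype.card V *
      (l * ((∑ x, ρ x).trace.re + η * Fintype.card E) +
        l⁻¹ * (δ * (∑ x, ρ x).trace.re + L * c)) := by
  have hsum : (∑ x, ρ x).PosSemidef := posSemidef_sum _ fun x _ => hρ x
  -- The term `η • 1` makes the sum invertible even when `∑ x, ρ x` is singular; it costs `η dim E`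
  -- in the trace.
  obtain ⟨R, N, hR, hN, hRN, hNR, hτ⟩ := exists_fourth_root
    (PosDef.posSemidef_add hsum ((PosDef.one (n := E) (R := ℂ)).smul hη))
  set τ := (∑ x, ρ x) + η • (1 : Matrix E E ℂ) with hτdef
  set W : X → Matrix E E ℂ := fun z => N * N * ρ z * (N * N) with hW
  have hNN : (N * N)ᴴ = N * N := by rw [conjTranspose_mul, hN.eq]
  have hWpos : ∀ z, (W z).PosSemidef := fun z => by
    have := (hρ z).mul_mul_conjTranspose_same (N * N)
    rwa [hNN] at this
  have hWsum : ∑ z, W z ≤ 1 := by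
    have e : ∑ z, W z = N * N * (∑ z, ρ z) * (N * N) := by
      simp only [hW, Matrix.mul_sum, Matrix.sum_mul]
    have e1 : N * N * τ * (N * N) = 1 := by
      rw [← hτ, show N * N * (R * R * (R * R)) * (N * N) =
        N * (N * R) * R * (R * (R * N) * N) by noncomm_ring, hRN, hNR]
      simp [hRN, hNR]
    rw [Matrix.le_iff, e, ← e1, hτdef, show N * N * (∑ x, ρ x + η • (1 : Matrix E E ℂ)) * (N * N) -
      N * N * (∑ z, ρ z) * (N * N) = N * N * (η • (1 : Matrix E E ℂ)) * (N * N) by noncomm_ring]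
    have := ((PosDef.one (n := E) (R := ℂ)).smul hη).posSemidef.mul_mul_conjTranspose_same (N * N)
    rwa [hNN] at this
  have hWle : ∀ {B : Matrix E E ℂ}, B.PosSemidef → ∑ z, (W z * B).trace.re ≤ B.trace.re := by
    intro B hB
    have := trace_mul_re_mono hB hWsum
    rw [Matrix.mul_one, Matrix.mul_sum, trace_sum, Complex.re_sum] at this
    simpa only [trace_mul_comm B] using this
  have hcσ : ∀ x, ∀ z, (W z * ρ x).trace.re ≤ c * (W z * σ).trace.re := by
    intro x z
    have := trace_mul_re_mono (hWpos z) (hc x)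
    rwa [Matrix.mul_smul, trace_smul, Complex.smul_re, smul_eq_mul] at this
  have hcσ' : ∑ z, c * (W z * σ).trace.re ≤ c := by
    rcases isEmpty_or_nonempty X with hX | ⟨⟨x⟩⟩
    · simpa using hc0
    · have hpos : (c • σ).PosSemidef := by
        have := (Matrix.le_iff.1 (hc x)).add (hρ x)
        rwa [sub_add_cancel] at this
      have := hWle hpos
      simp only [Matrix.mul_smul, trace_smul, Complex.smul_re, smul_eq_mul] at this
      exact this.trans (mul_le_of_le_one_right hc0 hσ1)
  set D : V → Matrix E E ℂ := fun v => ∑ x, s x v • ρ x with hD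
  have hDH : ∀ v, (D v).IsHermitian := by
    intro v
    rw [IsHermitian, hD]
    simp only [conjTranspose_sum, conjTranspose_smul, (hρ _).1.eq, star_trivial]
  have hmain := Finset.sum_le_sum fun v (_ : v ∈ Finset.univ) =>
    two_trace_contraction_mul_re_le (h1 v) (h2 v) (hDH v) hR hN hRN hNR hτ hl
  have eL : ∑ v, 2 * (Q v * D v).trace.re = 2 * ∑ v, ∑ x, s x v * (Q v * ρ x).trace.re := by
    rw [Finset.mul_sum]
    refine Finset.sum_congr rfl fun v _ => ?_
    simp only [hD, Matrix.mul_sum, Matrix.mul_smul, trace_sum, trace_smul, Complex.re_sum,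
      Complex.smul_re, smul_eq_mul]
  have eD : ∀ v, (N * N * D v * (N * N) * D v).trace.re =
      ∑ z, ∑ x, s x v * s z v * (W z * ρ x).trace.re := by
    intro v
    simp only [hD, hW, Matrix.mul_sum, Matrix.sum_mul, Matrix.mul_smul, Matrix.smul_mul, trace_sum,
      trace_smul, Complex.re_sum, Complex.smul_re, smul_eq_mul]
    rw [Finset.sum_comm]
    refine Finset.sum_congr rfl fun z _ => ?_
    rw [Finset.mul_sum]
    exact Finset.sum_congr rfl fun x _ => (mul_assoc _ _ _).symm
  have hV : (0 : ℝ) ≤ Fintype.card V := Nat.cast_nonneg _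
  have hcorr : ∑ v, (N * N * D v * (N * N) * D v).trace.re ≤
      Fintype.card V * (δ * (∑ x, ρ x).trace.re + L * c) := by
    have hz : ∀ z, ∑ x, (∑ v, s x v * s z v) * (W z * ρ x).trace.re ≤
        Fintype.card V * (δ * ∑ x, (W z * ρ x).trace.re + L * (c * (W z * σ).trace.re)) := by
      intro z
      -- Weakly correlated `x` use the bound `δ |V|` on the correlation. The others, at most `L` in
      -- number and including `z` itself when `δ < 1`, use the trivial bound `|V|` together with `ρ
      -- x ≤ c • σ`.
      have hterm : ∀ x, (∑ v, s x v * s z v) * (W z * ρ x).trace.re ≤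
          Fintype.card V * δ * (W z * ρ x).trace.re +
            if δ * Fintype.card V < ∑ v, s x v * s z v then
              Fintype.card V * (c * (W z * σ).trace.re) else 0 := by
        intro x
        have hp : 0 ≤ (W z * ρ x).trace.re := trace_mul_re_nonneg (hWpos z) (hρ x)
        have hle : ∑ v, s x v * s z v ≤ Fintype.card V := by
          have : ∀ v ∈ Finset.univ, s x v * s z v ≤ 1 := fun v _ =>
            (le_abs_self _).trans (by
              rw [abs_mul]; exact mul_le_one₀ (hs x v) (abs_nonneg _) (hs z v))
          simpa using Finset.sum_le_sum this
        split_ifs with h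
        · have := mul_le_mul_of_nonneg_right hle hp
          have h3 := mul_le_mul_of_nonneg_left (hcσ x z) hV
          have : 0 ≤ Fintype.card V * δ * (W z * ρ x).trace.re := by positivity
          linarith
        · have := mul_le_mul_of_nonneg_right (not_lt.1 h) hp
          linarith
      refine (Finset.sum_le_sum fun x _ => hterm x).trans ?_
      rw [Finset.sum_add_distrib, ← Finset.mul_sum, ← Finset.sum_filter, Finset.sum_const,
        nsmul_eq_mul]
      have hnn : 0 ≤ Fintype.card V * (c * (W z * σ).trace.re) := by
        rcases isEmpty_or_nonempty X with hX | ⟨⟨x⟩⟩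
        · exact (hX.false z).elim
        · exact mul_nonneg hV ((trace_mul_re_nonneg (hWpos z) (hρ x)).trans (hcσ x z))
      have := mul_le_mul_of_nonneg_right (hL z) hnn
      linarith
    have e : ∑ v, (N * N * D v * (N * N) * D v).trace.re =
        ∑ z, ∑ x, (∑ v, s x v * s z v) * (W z * ρ x).trace.re := by
      simp only [eD, Finset.sum_mul]
      rw [Finset.sum_comm]
      exact Finset.sum_congr rfl fun z _ => Finset.sum_comm
    rw [e]
    refine (Finset.sum_le_sum fun z _ => hz z).trans ?_
    rw [← Finset.mul_sum, Finset.sum_add_distrib, ← Finset.mul_sum, ← Finset.mul_sum]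
    refine mul_le_mul_of_nonneg_left (add_le_add (mul_le_mul_of_nonneg_left ?_ hδ) ?_) hV
    · rw [Finset.sum_comm, trace_sum, Complex.re_sum]
      exact Finset.sum_le_sum fun x _ => hWle (hρ x)
    · exact mul_le_mul_of_nonneg_left hcσ' hL0
  have hτt : τ.trace.re = (∑ x, ρ x).trace.re + η * Fintype.card E := by
    rw [hτdef, trace_add, trace_smul, trace_one, Complex.add_re]
    simp
  rw [eL, Finset.sum_add_distrib, ← Finset.mul_sum, Finset.sum_const, nsmul_eq_mul,
    Finset.card_univ, ← Finset.mul_sum, hτt] at hmain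
  have := mul_le_mul_of_nonneg_left hcorr (inv_nonneg.2 hl.le)
  linarith

/-- The bound for one-bit extractors in the presence of both the quantum side information and the
classical side information `g`. -/
lemma two_sum_sign_trace_le_of_side_information (s : X → V → ℝ) (hs : ∀ x v, |s x v| ≤ 1)
    {ρ : X → Matrix E E ℂ} (hρ : ∀ x, (ρ x).PosSemidef) (hρ1 : ∑ x, (ρ x).trace.re ≤ 1)
    (g : X → G) {Q : G → V → Matrix E E ℂ} (h1 : ∀ a v, (1 - Q a v).PosSemidef)
    (h2 : ∀ a v, (1 + Q a v).PosSemidef) {σ : Matrix E E ℂ} (hσ : σ.PosSemidef)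
    (hσ1 : σ.trace.re ≤ 1) {c : ℝ} (hc0 : 0 ≤ c) (hc : ∀ x, ρ x ≤ c • σ) {δ L : ℝ} (hδ : 0 ≤ δ)
    (hL0 : 0 ≤ L)
    (hL : ∀ z, ((Finset.univ.filter fun x => δ * Fintype.card V < ∑ v, s x v * s z v).card : ℝ)
      ≤ L) {l : ℝ} (hl : 0 < l) :
    2 * ∑ v, ∑ x, s x v * (Q (g x) v * ρ x).trace.re ≤ Fintype.card V *
      (2 * l + l⁻¹ * (δ + L * c * Fintype.card G)) := by
  -- Small enough that the regularization, paid once for each value of `g`, costs at most 1 in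
  -- total; hence `2 * l` in the bound.
  set η : ℝ := (Fintype.card G * Fintype.card E + 1 : ℝ)⁻¹ with hη
  have hη0 : 0 < η := by positivity
  have hη1 : η * (Fintype.card G * Fintype.card E) ≤ 1 := by
    rw [hη, inv_mul_eq_div, div_le_one (by positivity)]
    linarith
  have hcσ : (c • σ).PosSemidef := hσ.smul hc0
  -- Each value `a` of `g` gets its own unnormalized ensemble, still below `c • σ`. Their traces add
  -- up to at most 1, while the term `L * c` is paid `|G|` times.
  have key := Finset.sum_le_sum fun a (_ : a ∈ (Finset.univ : Finset G)) =>
    two_sum_sign_trace_le s hs (ρ := fun x => if g x = a then ρ x else 0)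
      (fun x => by
        split_ifs
        · exact hρ x
        · exact PosSemidef.zero)
      (h1 a) (h2 a) hσ1 hc0
      (fun x => by
        split_ifs
        · exact hc x
        · exact nonneg_iff_posSemidef.2 hcσ)
      hδ hL0 hL hη0 hl
  have e1 : ∑ a, 2 * ∑ v, ∑ x, s x v * (Q a v * if g x = a then ρ x else 0).trace.re =
      2 * ∑ v, ∑ x, s x v * (Q (g x) v * ρ x).trace.re := by
    rw [← Finset.mul_sum, Finset.sum_comm]
    congr 1
    refine Finset.sum_congr rfl fun v _ => ?_
    rw [Finset.sum_comm]
    refine Finset.sum_congr rfl fun x _ => ?_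
    rw [Finset.sum_eq_single (g x)]
    · simp
    · intro b _ hb; simp [hb.symm]
    · simp
  have e2 : ∑ a, (∑ x, if g x = a then ρ x else 0).trace.re = ∑ x, (ρ x).trace.re := by
    simp only [trace_sum, Complex.re_sum]
    rw [Finset.sum_comm]
    refine Finset.sum_congr rfl fun x _ => ?_
    rw [Finset.sum_eq_single (g x)]
    · simp
    · intro b _ hb; simp [hb.symm]
    · simp
  rw [e1, ← Finset.mul_sum, Finset.sum_add_distrib, ← Finset.mul_sum, ← Finset.mul_sum,
    Finset.sum_add_distrib, Finset.sum_add_distrib, ← Finset.mul_sum (f := fun a => (∑ x, if g x = a then ρ x else 0).trace.re), e2, Finset.sum_const,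
    Finset.sum_const, nsmul_eq_mul, nsmul_eq_mul, Finset.card_univ, mul_left_comm _ η] at key
  refine key.trans (mul_le_mul_of_nonneg_left (add_le_add ?_ ?_) (Nat.cast_nonneg _))
  · rw [mul_comm 2 l]
    exact mul_le_mul_of_nonneg_left (by linarith) hl.le
  · refine mul_le_mul_of_nonneg_left ?_ (inv_nonneg.2 hl.le)
    have := mul_le_mul_of_nonneg_left hρ1 hδ
    linarith

end OneBit

/-! ### List decoding as a bound on correlations -/

/-- The sign `(-1)^b`. -/
noncomputable def sign (b : Bool) : ℝ := if b then -1 else 1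

lemma abs_sign_le (b : Bool) : |sign b| ≤ 1 := by cases b <;> simp [sign]

lemma sum_sign_mul_sign {V : Type} [Fintype V] (a b : V → Bool) :
    ∑ v, sign (a v) * sign (b v) = Fintype.card V - 2 * (hammingDist a b : ℝ) := by
  have : ∀ v, sign (a v) * sign (b v) = 1 - 2 * if a v ≠ b v then 1 else 0 := by
    intro v
    cases a v <;> cases b v <;> norm_num [sign]
  simp only [this, Finset.sum_sub_distrib, ← Finset.mul_sum, hammingDist, Finset.sum_boole]
  simp

/-- Correlation above `δ |V|` means Hamming distance below `(1/2 - δ/2) |V|`, so the list-decoding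
ball centred at the codeword of `z` contains all these `x`. -/
lemma IsListDecodable.card_correlated_le {n : ℕ} {V : Type} [Fintype V] {C : Bits n → V → Bool}
    {δ L : ℝ} (h : IsListDecodable C (δ / 2) L) (z : Bits n) :
    ((Finset.univ.filter fun x =>
      δ * Fintype.card V < ∑ v, sign (C x v) * sign (C z v)).card : ℝ) ≤ L := by
  refine le_trans ?_ (h (C z))
  refine Nat.cast_le.2 (Finset.card_le_card ?_)
  intro x hx
  rw [Finset.mem_filter] at hx ⊢
  refine ⟨hx.1, ?_⟩
  have := hx.2
  rw [sum_sign_mul_sign] at this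
  linarith

/-! ### The hybrid argument -/

section Hybrid

variable {m : ℕ}

/-- The string consisting of the first `i` bits of `e` and the remaining bits of `w`. -/
def hybrid (i : ℕ) (e w : Bits m) : Bits m := fun j => if (j : ℕ) < i then e j else w j

lemma hybrid_succ (i : Fin m) (e w : Bits m) :
    hybrid (i + 1) e w = Function.update (hybrid i e w) i (e i) := by
  funext j
  by_cases h : j = i
  · subst h; simp [hybrid]
  · have : (j : ℕ) ≠ i := fun h' => h (Fin.ext h')
    rw [Function.update_of_ne h]
    have : (j : ℕ) < i + 1 ↔ (j : ℕ) < i := by omega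
    simp only [hybrid, this]

lemma hybrid_update (i : Fin m) (e w : Bits m) (b : Bool) :
    hybrid i e (Function.update w i b) = Function.update (hybrid i e w) i b := by
  funext j
  by_cases h : j = i
  · subst h; simp [hybrid]
  · rw [Function.update_of_ne h]
    simp only [hybrid, Function.update_of_ne h]

lemma sum_update_add_sum_update (G : Bits m → ℝ) (i : Fin m) :
    ∑ w, (G (Function.update w i true) + G (Function.update w i false)) = 2 * ∑ w, G w := by
  have hinv : Function.Involutive fun w : Bits m => Function.update w i (!w i) := by
    intro w; simp
  have h : ∀ w, G (Function.update w i true) + G (Function.update w i false) =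
      G w + G (Function.update w i (!w i)) := by
    intro w
    have hw := Function.update_eq_self i w
    cases hi : w i
    · rw [hi] at hw; rw [hw, Bool.not_false]; ring
    · rw [hi] at hw; rw [hw, Bool.not_true]
  simp only [h, Finset.sum_add_distrib]
  have := Equiv.sum_comp hinv.toPerm G
  rw [Function.Involutive.coe_toPerm] at this
  rw [this]; ring

/-- Telescoping over the hybrids between a given string and a uniformly random one. -/
lemma sub_average_eq_sum_hybrid (F : Bits m → ℝ) (e : Bits m) :
    F e - ((2 : ℝ) ^ m)⁻¹ * ∑ w, F w = ((2 : ℝ) ^ m)⁻¹ * ∑ i : Fin m, ∑ w, 1 / 2 * (sign (e i) *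
      (F (Function.update (hybrid i e w) i false) -
        F (Function.update (hybrid i e w) i true))) := by
  -- Replacing a uniform `i`-th bit by `e i` changes `F` by its value at `e i` minus the mean of its
  -- two values, which is half their signed difference.
  have hstep : ∀ i : Fin m, ∑ w, 1 / 2 * (sign (e i) *
      (F (Function.update (hybrid i e w) i false) - F (Function.update (hybrid i e w) i true))) =
      ∑ w, F (hybrid (i + 1) e w) - ∑ w, F (hybrid i e w) := by
    intro i
    have h2 := sum_update_add_sum_update (fun w => F (hybrid i e w)) i
    simp only [hybrid_update] at h2
    have h3 : ∑ w, F (hybrid i e w) = ∑ w, 1 / 2 * (F (Function.update (hybrid i e w) i true) +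
        F (Function.update (hybrid i e w) i false)) := by
      rw [← Finset.mul_sum, h2]; ring
    rw [h3, ← Finset.sum_sub_distrib]
    refine Finset.sum_congr rfl fun w _ => ?_
    rw [hybrid_succ]
    cases e i <;> simp only [sign] <;> norm_num <;> ring
  simp only [hstep]
  rw [Fin.sum_univ_eq_sum_range
    (fun i => ∑ w, F (hybrid (i + 1) e w) - ∑ w, F (hybrid i e w)), Finset.sum_range_sub
    (fun i => ∑ w, F (hybrid i e w))]
  have hm : ∀ w, hybrid m e w = e := by intro w; funext j; simp [hybrid]
  have h0 : ∀ w, hybrid 0 e w = w := by intro w; funext j; simp [hybrid]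
  simp only [hm, h0, Finset.sum_const, Finset.card_univ, nsmul_eq_mul]
  have : (Fintype.card (Bits m) : ℝ) = 2 ^ m := by simp
  rw [this]
  field_simp

end Hybrid

/-! ### Splitting the seed into the bits inside and outside a set -/

section Seed

variable {d t : ℕ}

/-- The string `y` with its bits at the positions in `S` replaced by `v`. -/
def overwrite (S : Finset (Fin d)) (hS : S.card = t) (y : Bits d) (v : Bits t) : Bits d :=
  fun p => if h : p ∈ S then v ((S.orderIsoOfFin hS).symm ⟨p, h⟩) else y p

lemma overwrite_of_notMem {S : Finset (Fin d)} (hS : S.card = t) (y : Bits d) (v : Bits t)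
    {p : Fin d} (h : p ∉ S) : overwrite S hS y v p = y p := dif_neg h

lemma restrict_overwrite {S : Finset (Fin d)} (hS : S.card = t) (y : Bits d) (v : Bits t) :
    restrict (overwrite S hS y v) S hS = v := by
  funext j
  have h : S.orderEmbOfFin hS j ∈ S := S.orderEmbOfFin_mem hS j
  simp only [restrict, overwrite, dif_pos h]
  congr 1
  rw [OrderIso.symm_apply_eq]
  ext
  simp

lemma overwrite_restrict {S : Finset (Fin d)} (hS : S.card = t) (y : Bits d) (v : Bits t) :
    overwrite S hS (overwrite S hS y v) (restrict y S hS) = y := by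
  funext p
  by_cases h : p ∈ S
  · simp only [overwrite, dif_pos h, restrict]
    congr 1
    rw [← Finset.coe_orderIsoOfFin_apply, OrderIso.apply_symm_apply]
  · rw [overwrite_of_notMem hS _ _ h, overwrite_of_notMem hS _ _ h]

lemma restrict_congr {S : Finset (Fin d)} (hS : S.card = t) {y y' : Bits d}
    (h : ∀ p ∈ S, y p = y' p) : restrict y S hS = restrict y' S hS :=
  funext fun j => h _ (S.orderEmbOfFin_mem hS j)

/-- Exchanging `v` with the bits of `y` on `S` is an involution of the pairs `(y, v)`, so
overwriting a uniform seed with uniform bits leaves it uniform. -/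
lemma sum_overwrite {S : Finset (Fin d)} (hS : S.card = t) (F : Bits d → ℝ) :
    ∑ y, ∑ v, F (overwrite S hS y v) = 2 ^ t * ∑ y, F y := by
  have hinv : Function.Involutive fun z : Bits d × Bits t =>
      (overwrite S hS z.1 z.2, restrict z.1 S hS) := by
    rintro ⟨y, v⟩
    simp only [overwrite_restrict, restrict_overwrite]
  have h := Equiv.sum_comp hinv.toPerm fun z : Bits d × Bits t => F z.1
  rw [Function.Involutive.coe_toPerm, Fintype.sum_prod_type, Fintype.sum_prod_type] at h
  rw [h, Finset.mul_sum]
  simp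

end Seed

/-! ### Unpredictability of the output bits -/

section Trevisan

open Matrix

variable {n t d m : ℕ} {E : Type} [Fintype E] [DecidableEq E]

/-- The tables of values of the output bits before the `i`-th one, as functions of the seed bits
that they share with the `i`-th one. -/
abbrev SharedTables (S : Fin m → Finset (Fin d)) (i : Fin m) : Type :=
  (j : {j : Fin m // j < i}) → ({p // p ∈ S j ∩ S i} → Bool) → Bool

/-- The table of bit `j` has `2 ^ |S j ∩ S i|` binary entries, so the sum bounded in the weak design
condition is exactly the total number of bits in the tables. -/
lemma IsWeakDesign.card_sharedTables_le {r : ℝ} {S : Fin m → Finset (Fin d)}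
    (hS : IsWeakDesign t r S) (i : Fin m) :
    (Fintype.card (SharedTables S i) : ℝ) ≤ (2 : ℝ) ^ (r * m) := by
  have e : (Fintype.card (SharedTables S i) : ℝ) =
      (2 : ℝ) ^ (∑ j ∈ Finset.univ.filter (fun j => j < i), (2 : ℝ) ^ (S j ∩ S i).card) := by
    have h1 : Fintype.card (SharedTables S i) =
        2 ^ ∑ j ∈ Finset.univ.filter (fun j => j < i), 2 ^ (S j ∩ S i).card := by
      rw [Fintype.card_pi, ← Finset.prod_pow_eq_pow_sum]
      simp only [Fintype.card_fun, Fintype.card_bool, Fintype.card_coe]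
      rw [← Finset.prod_subtype_eq_prod_filter, Finset.subtype_univ]
    rw [h1]
    push_cast
    rw [← Real.rpow_natCast]
    push_cast
    rfl
  rw [e]
  exact Real.rpow_le_rpow_of_exponent_le (by norm_num) (hS.2 i)

/-- The output bit `i` of Trevisan's extractor cannot be predicted from the preceding ones, the
seed and the side information. -/
lemma sum_sign_trevisan_le {C : Bits n → Bits t → Bool} {δ L : ℝ} (hδ : 0 ≤ δ) (hL0 : 0 ≤ L)
    (hC : IsListDecodable C (δ / 2) L) {r : ℝ} {S : Fin m → Finset (Fin d)}
    (hS : IsWeakDesign t r S) {ρ : Bits n → Matrix E E ℂ} (hρ : ∀ x, (ρ x).PosSemidef)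
    (hρ1 : ∑ x, (ρ x).trace.re ≤ 1) {σ : Matrix E E ℂ} (hσ : σ.PosSemidef)
    (hσ1 : σ.trace.re ≤ 1) {c : ℝ} (hc0 : 0 ≤ c) (hc : ∀ x, ρ x ≤ c • σ)
    {P : Bits m → Bits d → Matrix E E ℂ} (h0 : ∀ w y, (P w y).PosSemidef)
    (h1 : ∀ w y, (1 - P w y).PosSemidef) {l : ℝ} (hl : 0 < l) (i : Fin m) (w : Bits m) :
    ∑ y, ∑ x, 1 / 2 * (sign (trevisan C S hS.1 x y i) *
      ((P (Function.update (hybrid i (trevisan C S hS.1 x y) w) i false) y * ρ x).trace.re -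
        (P (Function.update (hybrid i (trevisan C S hS.1 x y) w) i true) y * ρ x).trace.re)) ≤
      2 ^ d * (1 / 4 * (2 * l + l⁻¹ * (δ + L * c * (2 : ℝ) ^ (r * m)))) := by
  set B := 1 / 4 * (2 * l + l⁻¹ * (δ + L * c * (2 : ℝ) ^ (r * m))) with hB
  set Φ : Bits d → ℝ := fun y => ∑ x, 1 / 2 * (sign (trevisan C S hS.1 x y i) *
      ((P (Function.update (hybrid i (trevisan C S hS.1 x y) w) i false) y * ρ x).trace.re -
        (P (Function.update (hybrid i (trevisan C S hS.1 x y) w) i true) y * ρ x).trace.re)) with hΦ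
  have hfix : ∀ y, ∑ v, Φ (overwrite (S i) (hS.1 i) y v) ≤ 2 ^ t * B := by
    intro y
    let ow : Bits t → Bits d := overwrite (S i) (hS.1 i) y
    -- With `y` fixed outside `S i`, the table `g x` does not depend on `v`, so it is classical side
    -- information about `x` alone; `dec` recovers the hybrid string from it and `v`.
    let g : Bits n → SharedTables S i := fun x j z =>
      C x (restrict (fun p => if h : p ∈ S j ∩ S i then z ⟨p, h⟩ else y p) (S j) (hS.1 j))
    let dec : SharedTables S i → Bits t → Bits m := fun a v j =>
      if h : j < i then a ⟨j, h⟩ (fun p => ow v p) else w j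
    have hdec : ∀ x v, hybrid i (trevisan C S hS.1 x (ow v)) w = dec (g x) v := by
      intro x v
      funext j
      by_cases h : j < i
      · have h' : (j : ℕ) < i := h
        simp only [hybrid, if_pos h', dec, dif_pos h, trevisan, g]
        congr 1
        refine restrict_congr _ fun p hp => ?_
        split_ifs with hpi
        · rfl
        · exact overwrite_of_notMem _ _ _ fun hpi' => hpi (Finset.mem_inter.2 ⟨hp, hpi'⟩)
      · have h' : ¬ (j : ℕ) < i := h
        simp only [hybrid, if_neg h', dec, dif_neg h]
    -- A difference of two tests satisfies `-1 ≤ Q ≤ 1`: each of `1 - Q` and `1 + Q` is a test plus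
    -- the complement of the other.
    let Q : SharedTables S i → Bits t → Matrix E E ℂ := fun a v =>
      P (Function.update (dec a v) i false) (ow v) - P (Function.update (dec a v) i true) (ow v)
    have key := two_sum_sign_trace_le_of_side_information (fun x v => sign (C x v))
      (fun x v => abs_sign_le _) hρ hρ1 g (Q := Q)
      (fun a v => by
        have := (h1 (Function.update (dec a v) i false) (ow v)).add
          (h0 (Function.update (dec a v) i true) (ow v))
        convert this using 1
        simp only [Q]; abel)
      (fun a v => by
        have := (h1 (Function.update (dec a v) i true) (ow v)).add
          (h0 (Function.update (dec a v) i false) (ow v))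
        convert this using 1
        simp only [Q]; abel)
      hσ hσ1 hc0 hc hδ hL0 hC.card_correlated_le hl
    have e : ∑ v, Φ (ow v) = 1 / 2 * ∑ v, ∑ x, sign (C x v) * (Q (g x) v * ρ x).trace.re := by
      rw [Finset.mul_sum]
      refine Finset.sum_congr rfl fun v _ => ?_
      rw [Finset.mul_sum]
      refine Finset.sum_congr rfl fun x _ => ?_
      have hbit : trevisan C S hS.1 x (ow v) i = C x v := by
        simp only [trevisan, ow, restrict_overwrite]
      rw [hdec, hbit, ← Complex.sub_re, ← trace_sub, ← Matrix.sub_mul]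
    have hcard : (Fintype.card (Bits t) : ℝ) = 2 ^ t := by simp
    rw [hcard] at key
    have hle : (2 * l + l⁻¹ * (δ + L * c * Fintype.card (SharedTables S i))) ≤ 4 * B := by
      rw [hB]
      have := mul_le_mul_of_nonneg_left (hS.card_sharedTables_le i) (mul_nonneg hL0 hc0)
      have := mul_le_mul_of_nonneg_left this (inv_nonneg.2 hl.le)
      linarith
    have := mul_le_mul_of_nonneg_left hle (by positivity : (0 : ℝ) ≤ 2 ^ t)
    change ∑ v, Φ (ow v) ≤ _
    rw [e]
    linarith
  have hsum := Finset.sum_le_sum fun y (_ : y ∈ Finset.univ) => hfix y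
  rw [sum_overwrite, Finset.sum_const, Finset.card_univ, nsmul_eq_mul] at hsum
  have hcard : (Fintype.card (Bits d) : ℝ) = 2 ^ d := by simp
  rw [hcard, mul_left_comm] at hsum
  exact le_of_mul_le_mul_left hsum (by positivity)

/-- The error of Trevisan's extractor in terms of the guessing bound `ρ x ≤ c • σ`. -/
lemma half_traceNorm_trevisan_le {C : Bits n → Bits t → Bool} {δ L : ℝ} (hδ : 0 ≤ δ) (hL0 : 0 ≤ L)
    (hC : IsListDecodable C (δ / 2) L) {r : ℝ} {S : Fin m → Finset (Fin d)}
    (hS : IsWeakDesign t r S) {ρ : Matrix (Bits n × E) (Bits n × E) ℂ}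
    (hρ : IsSubnormalizedState ρ) {σ : Matrix E E ℂ} (hσ : IsNormalizedState σ)
    {c : ℝ} (hc0 : 0 ≤ c) (hc : ρ ≤ c • ((1 : Matrix (Bits n) (Bits n) ℂ) ⊗ₖ σ)) {l : ℝ}
    (hl : 0 < l) :
    1 / 2 * traceNorm (outputState (trevisan C S hS.1) ρ - idealState d m ρ) ≤
      m * (1 / 4 * (2 * l + l⁻¹ * (δ + L * c * (2 : ℝ) ^ (r * m)))) := by
  obtain ⟨P, h0, h1, e⟩ := exists_distinguisher (trevisan C S hS.1) hρ.1
  have hb : ∀ x, block ρ x ≤ c • σ := by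
    intro x
    have := block_mono hc x
    convert this using 1
    ext a b
    simp [block]
  have ht : ∑ x, (block ρ x).trace.re ≤ 1 := by
    rw [← Complex.re_sum, ← trace_sum]
    change (reduceToSecond ρ).trace.re ≤ 1
    rw [trace_reduceToSecond]
    exact (Complex.le_def.1 hρ.2).1
  have hσ1 : σ.trace.re ≤ 1 := by rw [hσ.2]; simp
  set B := 1 / 4 * (2 * l + l⁻¹ * (δ + L * c * (2 : ℝ) ^ (r * m))) with hB
  let T : Bits n → Bits d → Fin m → Bits m → ℝ := fun x y i w =>
    1 / 2 * (sign (trevisan C S hS.1 x y i) *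
      ((P (Function.update (hybrid i (trevisan C S hS.1 x y) w) i false) y * block ρ x).trace.re -
        (P (Function.update (hybrid i (trevisan C S hS.1 x y) w) i true) y * block ρ x).trace.re))
  have hT : ∀ x y, (P (trevisan C S hS.1 x y) y * block ρ x).trace.re -
      ((2 : ℝ) ^ m)⁻¹ * ∑ w, (P w y * block ρ x).trace.re =
      ((2 : ℝ) ^ m)⁻¹ * ∑ i, ∑ w, T x y i w := fun x y =>
    sub_average_eq_sum_hybrid (fun w => (P w y * block ρ x).trace.re) _
  have hle : ∑ i, ∑ w, ∑ y, ∑ x, T x y i w ≤ ∑ _i : Fin m, ∑ _w : Bits m, 2 ^ d * B :=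
    Finset.sum_le_sum fun i _ => Finset.sum_le_sum fun w _ =>
      sum_sign_trevisan_le hδ hL0 hC hS (block_posSemidef hρ.1) ht hσ.1 hσ1 hc0 hb h0 h1 hl i w
  have hR : ∑ _i : Fin m, ∑ _w : Bits m, 2 ^ d * B = 2 ^ d * (2 ^ m * (m * B)) := by
    simp only [Finset.sum_const, Finset.card_univ, nsmul_eq_mul]
    simp
    ring
  have hswap : ∑ x, ∑ y, ∑ i, ∑ w, T x y i w = ∑ i, ∑ w, ∑ y, ∑ x, T x y i w := by
    rw [Finset.sum_comm]
    simp_rw [Finset.sum_comm (s := (Finset.univ : Finset (Bits n)))]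
    rw [Finset.sum_comm]
    exact Finset.sum_congr rfl fun i _ => Finset.sum_comm
  rw [e, Finset.sum_congr rfl fun x _ => Finset.sum_congr rfl fun y _ => hT x y]
  simp only [← Finset.mul_sum]
  rw [hswap, inv_mul_le_iff₀ (by positivity), inv_mul_le_iff₀ (by positivity)]
  rw [hR] at hle
  linarith

end Trevisan

/-! ### Weak designs -/

section Design

variable {t B : ℕ}

/-- The set that contains one element of each of `t` consecutive blocks of length `B`. -/
def transversal (f : Fin t → Fin B) : Finset (Fin (t * B)) :=
  Finset.univ.map ⟨fun l => finProdFinEquiv (l, f l), fun a b h => by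
    have := finProdFinEquiv.injective h
    exact (Prod.ext_iff.1 this).1⟩

lemma card_transversal (f : Fin t → Fin B) : (transversal f).card = t := by
  simp [transversal]

lemma transversal_inter (f g : Fin t → Fin B) :
    (transversal f ∩ transversal g).card = (Finset.univ.filter fun l => f l = g l).card := by
  have : transversal f ∩ transversal g = (Finset.univ.filter fun l => f l = g l).map
      ⟨fun l => finProdFinEquiv (l, f l), fun a b h => by
        have := finProdFinEquiv.injective h
        exact (Prod.ext_iff.1 this).1⟩ := by
    ext p
    simp only [transversal, Finset.mem_inter, Finset.mem_map, Finset.mem_univ, true_and,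
      Finset.mem_filter]
    constructor
    · rintro ⟨⟨a, rfl⟩, b, hb⟩
      have h := Prod.ext_iff.1 (finProdFinEquiv.injective hb)
      obtain rfl : b = a := h.1
      exact ⟨b, h.2.symm, rfl⟩
    · rintro ⟨a, ha, rfl⟩
      exact ⟨⟨a, rfl⟩, a, congrArg (fun b => finProdFinEquiv (a, b)) ha.symm⟩
  rw [this, Finset.card_map]

/-- Each coordinate contributes an independent factor: 2 for the one agreeing value and 1 for each
of the other `B - 1`. On average the power of two is therefore `(1 + 1/B) ^ t`. -/
lemma sum_two_pow_agreement (g : Fin t → Fin B) :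
    ∑ f : Fin t → Fin B, (2 : ℝ) ^ (Finset.univ.filter fun l => g l = f l).card =
      ((B : ℝ) + 1) ^ t := by
  have h : ∀ f : Fin t → Fin B, (2 : ℝ) ^ (Finset.univ.filter fun l => g l = f l).card =
      ∏ l, if g l = f l then 2 else 1 := by
    intro f
    rw [Finset.prod_ite]
    simp
  simp only [h]
  have := Finset.prod_univ_sum (fun _ : Fin t => (Finset.univ : Finset (Fin B)))
    (fun l b => if g l = b then (2 : ℝ) else 1)
  rw [Fintype.piFinset_univ] at this
  rw [← this]
  have h2 : ∀ l, ∑ b : Fin B, (if g l = b then (2 : ℝ) else 1) = B + 1 := by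
    intro l
    have : ∀ b, (if g l = b then (2 : ℝ) else 1) = 1 + if g l = b then 1 else 0 := by
      intro b; split_ifs <;> norm_num
    simp [this, Finset.sum_add_distrib]
  simp [h2]

/-- Greedy choice of a transversal with few expected intersections. -/
lemma exists_agreement_le (hB : 0 < B) {r : ℝ} (hr : ((B : ℝ) + 1) ^ t ≤ r * (B : ℝ) ^ t) {i : ℕ}
    (F : Fin i → Fin t → Fin B) :
    ∃ f : Fin t → Fin B, ∑ j, (2 : ℝ) ^ (Finset.univ.filter fun l => F j l = f l).card ≤ r * i := by
  have : Nonempty (Fin B) := ⟨⟨0, hB⟩⟩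
  have h : ∑ f : Fin t → Fin B, ∑ j, (2 : ℝ) ^ (Finset.univ.filter fun l => F j l = f l).card ≤
      ∑ _f : Fin t → Fin B, r * i := by
    rw [Finset.sum_comm]
    simp only [sum_two_pow_agreement, Finset.sum_const, Finset.card_univ, nsmul_eq_mul]
    simp only [Fintype.card_fin, Fintype.card_fun]
    push_cast
    have := mul_le_mul_of_nonneg_left hr (Nat.cast_nonneg (α := ℝ) i)
    linarith
  obtain ⟨f, _, hf⟩ := Finset.exists_le_of_sum_le Finset.univ_nonempty h
  exact ⟨f, hf⟩

lemma exists_agreement_sequence (hB : 0 < B) {r : ℝ}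
    (hr : ((B : ℝ) + 1) ^ t ≤ r * (B : ℝ) ^ t) (m : ℕ) :
    ∃ F : Fin m → Fin t → Fin B, ∀ i, ∑ j ∈ Finset.univ.filter (fun j => j < i),
      (2 : ℝ) ^ (Finset.univ.filter fun l => F j l = F i l).card ≤ r * (i : ℕ) := by
  induction m with
  | zero => exact ⟨fun i => i.elim0, fun i => i.elim0⟩
  | succ m ih =>
    obtain ⟨F, hF⟩ := ih
    obtain ⟨f, hf⟩ := exists_agreement_le hB hr F
    refine ⟨Fin.snoc F f, fun i => ?_⟩
    rw [Finset.sum_filter, Fin.sum_univ_castSucc]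
    induction i using Fin.lastCases with
    | last =>
      simpa [Fin.castSucc_lt_last] using hf
    | cast i =>
      have := hF i
      rw [Finset.sum_filter] at this
      have h2 : ¬ Fin.last m < i.castSucc := not_lt.2 (Fin.le_last _)
      simpa [h2] using this

/-- The weak designs of Raz, Reingold and Vadhan. -/
lemma exists_isWeakDesign (t m : ℕ) {r : ℝ} (hr : 1 < r) :
    ∃ S : Fin m → Finset (Fin (rrvSeedLength t r)), IsWeakDesign t r S := by
  have hlog : 0 < Real.log r := Real.log_pos hr
  -- For `t = 0` the block length is 0 and every set is empty; each summand is 1, and `r > 1`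
  -- suffices.
  rcases Nat.eq_zero_or_pos t with rfl | ht
  · refine ⟨fun _ => ∅, fun _ => rfl, fun i => ?_⟩
    have hc : ((Finset.univ.filter fun j => j < i).card : ℝ) ≤ m := by
      have := Finset.card_le_univ (Finset.univ.filter fun j => j < i)
      rw [Fintype.card_fin] at this
      exact_mod_cast this
    have hm : (0 : ℝ) ≤ m := Nat.cast_nonneg m
    simp only [Finset.inter_self, Finset.card_empty, pow_zero, Finset.sum_const, nsmul_eq_mul,
      mul_one]
    nlinarith
  · have ht' : (0 : ℝ) < t := Nat.cast_pos.2 ht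
    set B := ⌈(t : ℝ) / Real.log r⌉₊ with hB
    have hBt : (t : ℝ) / Real.log r ≤ B := Nat.le_ceil _
    have hB0 : 0 < B := Nat.ceil_pos.2 (div_pos ht' hlog)
    have hB0' : (0 : ℝ) < B := Nat.cast_pos.2 hB0
    -- `(1 + 1/B) ^ t ≤ exp (t / B) ≤ r`, which is why `B` is `t / log r` rounded up.
    have hr' : ((B : ℝ) + 1) ^ t ≤ r * (B : ℝ) ^ t := by
      have h1 : (B : ℝ) + 1 ≤ Real.exp (1 / B) * B := by
        have := mul_le_mul_of_nonneg_right (Real.add_one_le_exp (1 / (B : ℝ))) hB0'.le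
        have e : (1 / (B : ℝ) + 1) * B = B + 1 := by field_simp; ring
        linarith
      refine (pow_le_pow_left₀ (by positivity) h1 t).trans ?_
      rw [mul_pow, ← Real.exp_nat_mul]
      refine mul_le_mul_of_nonneg_right ?_ (by positivity)
      rw [← Real.le_log_iff_exp_le (by linarith), mul_one_div, div_le_iff₀ hB0']
      rwa [div_le_iff₀ hlog, mul_comm] at hBt
    obtain ⟨F, hF⟩ := exists_agreement_sequence hB0 hr' m
    refine ⟨fun i => transversal (F i), fun i => card_transversal _, fun i => ?_⟩
    have e : ∑ j ∈ Finset.univ.filter (fun j => j < i),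
        (2 : ℝ) ^ (transversal (F j) ∩ transversal (F i)).card = ∑ j ∈ Finset.univ.filter
        (fun j => j < i), (2 : ℝ) ^ (Finset.univ.filter fun l => F j l = F i l).card :=
      Finset.sum_congr rfl fun j _ => by rw [transversal_inter]
    refine (e.trans_le (hF i)).trans (mul_le_mul_of_nonneg_left ?_ (by linarith))
    exact_mod_cast i.2.le

end Design

/-! ### Existence of list-decodable codes -/

section Codes

open Polynomial

/-- The Johnson bound: nearly uncorrelated codewords form a list-decodable code. -/
lemma isListDecodable_of_correlation_le {n : ℕ} {V : Type} [Fintype V] [Nonempty V]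
    {C : Bits n → V → Bool} {δ : ℝ} (hδ : 0 < δ)
    (hC : ∀ x z, x ≠ z → ∑ v, sign (C x v) * sign (C z v) ≤ δ ^ 2 / 2 * Fintype.card V) :
    IsListDecodable C (δ / 2) (1 / (δ / 2) ^ 2) := by
  intro w
  set T := Finset.univ.filter fun x : Bits n =>
      (hammingDist (C x) w : ℝ) ≤ (1 / 2 - δ / 2) * Fintype.card V with hT
  have hN : (0 : ℝ) < Fintype.card V := Nat.cast_pos.2 Fintype.card_pos
  have hss : ∀ b, sign b * sign b = 1 := by intro b; cases b <;> norm_num [sign]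
  have h1 : T.card * (δ * Fintype.card V) ≤ ∑ v, (∑ x ∈ T, sign (C x v)) * sign (w v) := by
    simp only [Finset.sum_mul]
    rw [Finset.sum_comm, ← nsmul_eq_mul, ← Finset.sum_const]
    refine Finset.sum_le_sum fun x hx => ?_
    rw [sum_sign_mul_sign]
    have := (Finset.mem_filter.1 hx).2
    linarith
  have h2 : ∑ v, (∑ x ∈ T, sign (C x v)) ^ 2 ≤
      Fintype.card V * (T.card + δ ^ 2 / 2 * T.card ^ 2) := by
    have e : ∑ v, (∑ x ∈ T, sign (C x v)) ^ 2 =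
        ∑ x ∈ T, ∑ z ∈ T, ∑ v, sign (C x v) * sign (C z v) := by
      simp only [sq, Finset.sum_mul_sum]
      rw [Finset.sum_comm]
      exact Finset.sum_congr rfl fun x _ => Finset.sum_comm
    have hxz : ∀ x ∈ T, ∀ z ∈ T, ∑ v, sign (C x v) * sign (C z v) ≤
        δ ^ 2 / 2 * Fintype.card V + if x = z then (Fintype.card V : ℝ) else 0 := by
      intro x _ z _
      split_ifs with h
      · subst h
        simp only [hss, Finset.sum_const, Finset.card_univ, nsmul_eq_mul, mul_one]
        have : 0 ≤ δ ^ 2 / 2 * Fintype.card V := by positivity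
        linarith
      · simpa using hC x z h
    rw [e]
    refine (Finset.sum_le_sum fun x hx => Finset.sum_le_sum fun z hz => hxz x hx z hz).trans ?_
    simp only [Finset.sum_add_distrib, Finset.sum_const, nsmul_eq_mul, Finset.sum_ite_eq]
    rw [← Finset.sum_filter, Finset.filter_mem_eq_inter, Finset.inter_self, Finset.sum_const,
      nsmul_eq_mul]
    apply le_of_eq; ring
  have h3 := Finset.sum_mul_sq_le_sq_mul_sq Finset.univ (fun v => ∑ x ∈ T, sign (C x v))
    (fun v => sign (w v))
  have h4 : ∑ v, sign (w v) ^ 2 = Fintype.card V := by simp [sq, hss]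
  rw [h4] at h3
  have h5 : (T.card * (δ * Fintype.card V)) ^ 2 ≤
      (Fintype.card V * (T.card + δ ^ 2 / 2 * T.card ^ 2)) * Fintype.card V :=
    (pow_le_pow_left₀ (by positivity) h1 2).trans
      (h3.trans (mul_le_mul_of_nonneg_right h2 hN.le))
  -- Cauchy–Schwarz between the sum of the codeword signs over `T` and the sign vector of `w`. It
  -- gives `|T| ≤ 2 / δ²`, half the required list size.
  have h6 : (T.card : ℝ) ^ 2 * δ ^ 2 ≤ T.card + δ ^ 2 / 2 * T.card ^ 2 := by
    refine le_of_mul_le_mul_right ?_ (by positivity : (0 : ℝ) < Fintype.card V ^ 2)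
    linarith
  rw [le_div_iff₀ (by positivity)]
  rcases Nat.eq_zero_or_pos T.card with h0 | hpos
  · rw [h0]; norm_num
  · have hpos' : (0 : ℝ) < T.card := Nat.cast_pos.2 hpos
    have h7 : (T.card : ℝ) * (T.card * δ ^ 2) ≤ T.card * 2 := by linarith
    have := le_of_mul_le_mul_left h7 hpos'
    linarith

/-- The sign character of `ZMod 2`. -/
noncomputable def zmodSign (a : ZMod 2) : ℝ := sign (decide (a ≠ 0))

lemma zmodSign_sub (a b : ZMod 2) : zmodSign (a - b) = zmodSign a * zmodSign b := by
  have : ∀ a b : ZMod 2, decide (a - b ≠ 0) = (decide (a ≠ 0)).xor (decide (b ≠ 0)) := by decide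
  rw [zmodSign, this, zmodSign, zmodSign]
  cases decide (a ≠ 0) <;> cases decide (b ≠ 0) <;> norm_num [sign]

variable {F : Type} [Field F] [Fintype F] [DecidableEq F] [Algebra (ZMod 2) F]

/-- Translating `b` by `y / u` with `φ y ≠ 0` flips every sign, so the sum equals its negative. -/
lemma sum_zmodSign_mul (φ : F →ₗ[ZMod 2] ZMod 2) (hφ : φ ≠ 0) {u : F} (hu : u ≠ 0) :
    ∑ b, zmodSign (φ (b * u)) = 0 := by
  obtain ⟨y, hy⟩ : ∃ y, φ y ≠ 0 := by
    by_contra h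
    push Not at h
    exact hφ (LinearMap.ext h)
  have h := Equiv.sum_comp (Equiv.subRight (y / u)) fun b => zmodSign (φ (b * u))
  have e : ∀ b, zmodSign (φ (Equiv.subRight (y / u) b * u)) = -zmodSign (φ (b * u)) := by
    intro b
    rw [Equiv.subRight_apply, sub_mul, div_mul_cancel₀ _ hu, map_sub, zmodSign_sub]
    have : zmodSign (φ y) = -1 := by simp [zmodSign, sign, hy]
    rw [this]; ring
  simp only [e, Finset.sum_neg_distrib] at h
  linarith

/-- The polynomial over `F` whose coefficients are the bits of `x`. -/
noncomputable def bitsPolynomial {n : ℕ} (x : Bits n) : F[X] := ofFn n fun i => if x i then 1 else 0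

lemma bitsPolynomial_injective {n : ℕ} :
    Function.Injective (bitsPolynomial : Bits n → F[X]) := by
  intro x z h
  funext i
  have h1 := congrFun (injective_ofFn n h) i
  cases hx : x i <;> cases hz : z i <;> simp [hx, hz] at h1 ⊢

/-- The concatenation of a Reed–Solomon code with a Hadamard code. -/
noncomputable def concatenatedCode (φ : F →ₗ[ZMod 2] ZMod 2) {n : ℕ} (x : Bits n) (p : F × F) : Bool :=
  decide (φ (p.2 * (bitsPolynomial x).eval p.1) ≠ 0)

/-- The Hadamard sum over `b` vanishes unless the two polynomials agree at `a`, which happens for at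
most `n` points. -/
lemma sum_sign_concatenatedCode_le (φ : F →ₗ[ZMod 2] ZMod 2) (hφ : φ ≠ 0) {n : ℕ} {x z : Bits n}
    (hxz : x ≠ z) :
    ∑ p, sign (concatenatedCode φ x p) * sign (concatenatedCode φ z p) ≤ n * Fintype.card F := by
  set D : F[X] := bitsPolynomial x - bitsPolynomial z with hD
  have hD0 : D ≠ 0 := sub_ne_zero.2 (bitsPolynomial_injective.ne hxz)
  have hdeg : D.natDegree ≤ n := by
    refine natDegree_le_of_degree_le ?_
    exact (degree_sub_le _ _).trans
      (max_le (ofFn_degree_lt _).le (ofFn_degree_lt _).le)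
  have e : ∀ a, ∑ b, sign (concatenatedCode φ x (a, b)) * sign (concatenatedCode φ z (a, b)) =
      if D.eval a = 0 then (Fintype.card F : ℝ) else 0 := by
    intro a
    have e1 : ∀ b, sign (concatenatedCode φ x (a, b)) * sign (concatenatedCode φ z (a, b)) =
        zmodSign (φ (b * D.eval a)) := by
      intro b
      rw [hD, eval_sub, mul_sub, map_sub, zmodSign_sub]
      rfl
    simp only [e1]
    split_ifs with h
    · simp [h, zmodSign, sign]
    · exact sum_zmodSign_mul φ hφ h
  rw [Fintype.sum_prod_type]
  simp only [e]
  rw [← Finset.sum_filter, Finset.sum_const, nsmul_eq_mul]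
  refine mul_le_mul_of_nonneg_right ?_ (Nat.cast_nonneg _)
  have hsub : (Finset.univ.filter fun a => D.eval a = 0) ⊆ D.roots.toFinset := by
    intro a ha
    rw [Multiset.mem_toFinset, mem_roots hD0]
    exact (Finset.mem_filter.1 ha).2
  exact_mod_cast (Finset.card_le_card hsub).trans
    ((Multiset.toFinset_card_le _).trans ((card_roots' D).trans hdeg))

lemma exists_listDecodable_code {n : ℕ} (hn : 1 ≤ n) {δ : ℝ} (hδ : 0 < δ) (hδ1 : δ ≤ 1) :
    ∃ (t : ℕ) (C : Bits n → Bits t → Bool), IsListDecodable C (δ / 2) (1 / (δ / 2) ^ 2) ∧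
      (t : ℝ) ≤ 8 * Real.logb 2 (n / δ) := by
  have hn0 : (0 : ℝ) < n := Nat.cast_pos.2 hn
  rcases Nat.lt_or_ge n 2 with h2 | h2
  -- Here `log (n/δ)` vanishes at `δ = 1`, forcing length exponent 0 there. A constant code works
  -- since both messages fit in a list of size `4/δ² ≥ 4`.
  · obtain rfl : n = 1 := by omega
    refine ⟨0, fun _ _ => false, fun w => ?_, ?_⟩
    · have h1 := Finset.card_le_univ (Finset.univ.filter fun x : Bits 1 =>
        (hammingDist (fun _ : Bits 0 => false) w : ℝ) ≤ (1 / 2 - δ / 2) * Fintype.card (Bits 0))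
      have hc : Fintype.card (Bits 1) = 2 := by simp
      rw [hc] at h1
      have h3 : (2 : ℝ) ≤ 1 / (δ / 2) ^ 2 := by
        rw [le_div_iff₀ (by positivity)]
        nlinarith
      exact (Nat.cast_le.2 h1).trans (by exact_mod_cast h3)
    · have : 0 ≤ Real.logb 2 ((1 : ℕ) / δ) :=
        Real.logb_nonneg (by norm_num) (by rw [le_div_iff₀ hδ]; push_cast; linarith)
      push_cast at this ⊢
      linarith
  · have hn2 : (2 : ℝ) ≤ n := by exact_mod_cast h2
    have hlog2 : 1 ≤ Real.logb 2 n := by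
      rw [Real.le_logb_iff_rpow_le (by norm_num) hn0]; simpa using hn2
    have hlogδ : Real.logb 2 δ ≤ 0 := Real.logb_nonpos (by norm_num) hδ.le hδ1
    -- This field size makes the correlation bound `n |F|` at most `(δ²/2) |F|²`, as the Johnson
    -- bound requires.
    set s := ⌈Real.logb 2 (2 * n / δ ^ 2)⌉₊ with hs
    have hlogs : Real.logb 2 (2 * n / δ ^ 2) = 1 + Real.logb 2 n - 2 * Real.logb 2 δ := by
      rw [Real.logb_div (by positivity) (by positivity), Real.logb_mul (by norm_num) hn0.ne',
        Real.logb_pow, Real.logb_self_eq_one (by norm_num)]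
      push_cast; ring
    have hs0 : s ≠ 0 := by
      have : 0 < s := Nat.ceil_pos.2 (by rw [hlogs]; linarith)
      omega
    have hspow : 2 * n / δ ^ 2 ≤ (2 : ℝ) ^ s := by
      rw [← Real.rpow_natCast 2 s, ← Real.logb_le_iff_le_rpow (by norm_num) (by positivity)]
      exact Nat.le_ceil _
    let F := GaloisField 2 s
    let _ : Fintype F := Fintype.ofFinite F
    let _ : DecidableEq F := Classical.decEq F
    have hcard : Fintype.card F = 2 ^ s := by
      rw [← Nat.card_eq_fintype_card]; exact GaloisField.card 2 s hs0
    obtain ⟨φ, hφ⟩ : ∃ φ : F →ₗ[ZMod 2] ZMod 2, φ ≠ 0 := by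
      by_contra! h
      exact one_ne_zero ((Module.forall_dual_apply_eq_zero_iff (ZMod 2) (1 : F)).1 fun φ => by
        rw [h φ, LinearMap.zero_apply])
    let e : Bits (s + s) ≃ F × F := Fintype.equivOfCardEq (by
      rw [Fintype.card_prod, hcard, ← pow_add]; simp)
    refine ⟨s + s, fun x y => concatenatedCode φ x (e y), ?_, ?_⟩
    · refine isListDecodable_of_correlation_le hδ fun x z hxz => ?_
      rw [Equiv.sum_comp e fun p => sign (concatenatedCode φ x p) * sign (concatenatedCode φ z p)]
      refine (sum_sign_concatenatedCode_le φ hφ hxz).trans ?_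
      rw [Fintype.card_congr e, Fintype.card_prod, hcard]
      push_cast
      rw [div_le_iff₀ (by positivity)] at hspow
      rw [← mul_assoc]
      refine mul_le_mul_of_nonneg_right ?_ (by positivity)
      linarith
    · have h1 : (s : ℝ) < Real.logb 2 (2 * n / δ ^ 2) + 1 :=
        Nat.ceil_lt_add_one (by rw [hlogs]; linarith)
      rw [hlogs] at h1
      rw [Real.logb_div hn0.ne' hδ.ne']
      push_cast
      linarith

lemma exists_isCodeExtractorFamily :
    ∃ (K : ℝ) (t : ℕ → ℝ → ℕ) (C : (n : ℕ) → (δ : ℝ) → Bits n → Bits (t n δ) → Bool),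
      IsCodeExtractorFamily K t C := by
  have h : ∀ (n : ℕ) (δ : ℝ), ∃ (t : ℕ) (C : Bits n → Bits t → Bool), 1 ≤ n → 0 < δ → δ ≤ 1 →
      IsListDecodable C (δ / 2) (1 / (δ / 2) ^ 2) ∧ (t : ℝ) ≤ 8 * Real.logb 2 (n / δ) := by
    intro n δ
    by_cases hc : 1 ≤ n ∧ 0 < δ ∧ δ ≤ 1
    · obtain ⟨t, C, h⟩ := exists_listDecodable_code hc.1 hc.2.1 hc.2.2
      exact ⟨t, C, fun _ _ _ => h⟩
    -- Arbitrary values outside the admissible parameters, so that the choice is made for all `n`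
    -- and `δ`.
    · exact ⟨0, fun _ _ => false, fun h1 h2 h3 => (hc ⟨h1, h2, h3⟩).elim⟩
  choose t C h using h
  exact ⟨8, t, C, fun n hn δ => h n δ hn⟩

end Codes

/-! ### Choice of parameters -/

lemma IsQuantumProofStrongExtractor.mono {n d m : ℕ} {Ext : Bits n → Bits d → Bits m}
    {k k' ε : ℝ} (h : IsQuantumProofStrongExtractor Ext k ε) (hk : k ≤ k') :
    IsQuantumProofStrongExtractor Ext k' ε := fun E _ _ ρ h1 h2 h3 =>
  h E ρ h1 h2 ((EReal.coe_le_coe_iff.2 hk).trans h3)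

/-- Trevisan's extractor with a list-decodable code and a weak design is quantum-proof. -/
lemma isQuantumProofStrongExtractor_trevisan {n t d m : ℕ} (hm : 1 ≤ m)
    {C : Bits n → Bits t → Bool} {ε : ℝ} (hε : 0 < ε) (hε1 : ε ≤ 1)
    {δ : ℝ} (hδ : δ = ε ^ 2 / (9 * (m : ℝ) ^ 2))
    (hC : IsListDecodable C (δ / 2) (1 / (δ / 2) ^ 2)) {r : ℝ} {S : Fin m → Finset (Fin d)}
    (hS : IsWeakDesign t r S) :
    IsQuantumProofStrongExtractor (trevisan C S hS.1)
      (r * m + 8 * Real.logb 2 m + 8 * Real.logb 2 (1 / ε) + 20) ε := by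
  intro E _ _ ρ hρ _ hk
  have hm0 : (1 : ℝ) ≤ m := by exact_mod_cast hm
  have hm1 : (0 : ℝ) < m := by linarith
  have hδ0 : 0 < δ := by rw [hδ]; positivity
  set q := ε / (3 * m) with hq
  have hq0 : 0 < q := by positivity
  have hq1 : q ≤ 1 := by rw [hq, div_le_one (by positivity)]; linarith
  have hδq : δ = q ^ 2 := by rw [hδ, hq]; field_simp; norm_num
  -- The supremum need not be known to be attained: an exponent `k'` exceeding the threshold minus 1
  -- suffices, so the constant 20 becomes 19.
  obtain ⟨_, ⟨k', ⟨σ, hσ, hle⟩, rfl⟩, hlt⟩ := lt_sSup_iff.1 (lt_of_lt_of_le (b :=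
    ((r * m + 8 * Real.logb 2 m + 8 * Real.logb 2 (1 / ε) + 20 : ℝ) : EReal))
    (a := ((r * m + 8 * Real.logb 2 m + 8 * Real.logb 2 (1 / ε) + 19 : ℝ) : EReal))
    (EReal.coe_lt_coe_iff.2 (by linarith)) hk)
  have hlt' := EReal.coe_lt_coe_iff.1 hlt
  have hc : (2 : ℝ) ^ (-k') * (2 : ℝ) ^ (r * m) ≤ (ε / m) ^ 8 / 2 ^ 19 := by
    rw [← Real.rpow_add (by norm_num), ← Real.le_logb_iff_rpow_le (by norm_num) (by positivity),
      Real.logb_div (by positivity) (by positivity), Real.logb_pow,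
      Real.logb_div hε.ne' hm1.ne', Real.logb_pow, Real.logb_self_eq_one (by norm_num)]
    rw [one_div, Real.logb_inv] at hlt'
    push_cast
    linarith
  -- The weight `l = q = √δ` balances `l` against `δ / l`. The error is then at most `m q = ε / 3`,
  -- well within the target.
  have h := half_traceNorm_trevisan_le hδ0.le (by positivity) hC hS hρ hσ
    (Real.rpow_nonneg (by norm_num) (-k')) hle hq0
  refine h.trans ?_
  have hεm : ε / m = 3 * q := by rw [hq]; field_simp
  have h1 : 1 / (δ / 2) ^ 2 * (2 : ℝ) ^ (-k') * (2 : ℝ) ^ (r * m) ≤ q ^ 2 := by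
    rw [mul_assoc]
    refine (mul_le_mul_of_nonneg_left hc (by positivity)).trans ?_
    rw [hεm, hδq]
    have e : 1 / (q ^ 2 / 2) ^ 2 * ((3 * q) ^ 8 / 2 ^ 19) = (4 * 3 ^ 8 / 2 ^ 19) * (q ^ 2 * q ^ 2) := by
      field_simp
      norm_num
    rw [e]
    have h2 : q ^ 2 ≤ 1 := pow_le_one₀ hq0.le hq1
    have h3 : q ^ 2 * q ^ 2 ≤ q ^ 2 * 1 := mul_le_mul_of_nonneg_left h2 (by positivity)
    have h4 : 0 < q ^ 2 := by positivity
    norm_num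
    linarith
  have h5 : q⁻¹ * (δ + 1 / (δ / 2) ^ 2 * (2 : ℝ) ^ (-k') * (2 : ℝ) ^ (r * m)) ≤ 2 * q := by
    rw [inv_mul_le_iff₀ hq0]
    rw [← hδq] at h1
    nlinarith
  have h6 : ε = m * (3 * q) := by rw [hq]; field_simp
  rw [h6]
  exact mul_le_mul_of_nonneg_left (by linarith) hm1.le

/-- The seed length of Trevisan's extractor. -/
lemma rrvSeedLength_le {n m t : ℕ} {a γ ε K : ℝ} (hn : 2 ≤ n) (hm : 1 ≤ m) (ha : 0 < a)
    (hγ : 0 < γ) (hγ1 : γ ≤ 1) (hε : (n : ℝ) ^ (-a) ≤ ε) (hε1 : ε ≤ 1)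
    (hmn : (m : ℝ) ≤ n)
    (ht : (t : ℝ) ≤ K * Real.logb 2 (n / (ε ^ 2 / (9 * (m : ℝ) ^ 2)))) :
    (rrvSeedLength t ((n : ℝ) ^ γ) : ℝ) ≤
      ((|K| * (7 + 2 * a)) ^ 2 * 2 + |K| * (7 + 2 * a)) * (1 / γ * Real.logb 2 n) := by
  have hn2 : (2 : ℝ) ≤ n := by exact_mod_cast hn
  have hn0 : (0 : ℝ) < n := by linarith
  have hm0 : (1 : ℝ) ≤ m := by exact_mod_cast hm
  have hε0 : 0 < ε := (Real.rpow_pos_of_pos hn0 _).trans_le hε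
  set N := Real.logb 2 n with hN
  have hN1 : 1 ≤ N := by
    rw [hN, Real.le_logb_iff_rpow_le (by norm_num) hn0]; simpa using hn2
  have hlogε : -a * N ≤ Real.logb 2 ε := by
    rw [Real.le_logb_iff_rpow_le (by norm_num) hε0]
    refine le_trans (le_of_eq ?_) hε
    rw [mul_comm, Real.rpow_mul (by norm_num), hN, Real.rpow_logb (by norm_num) (by norm_num) hn0]
  have hlogm : Real.logb 2 m ≤ N := Real.logb_le_logb_of_le (by norm_num) (by linarith) hmn
  have hlog9 : Real.logb 2 9 ≤ 4 := by
    rw [Real.logb_le_iff_le_rpow (by norm_num) (by norm_num)]; norm_num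
  -- `log (n/δ) = log n + 2 log (1/ε) + log 9 + 2 log m`, bounded by `1 + 2a + 4 + 2` times `log n`.
  have hlog : Real.logb 2 (n / (ε ^ 2 / (9 * (m : ℝ) ^ 2))) ≤ (7 + 2 * a) * N := by
    rw [Real.logb_div hn0.ne' (by positivity), Real.logb_div (by positivity) (by positivity),
      Real.logb_mul (by norm_num) (by positivity), Real.logb_pow, Real.logb_pow]
    push_cast
    nlinarith
  have hlog0 : 0 ≤ Real.logb 2 (n / (ε ^ 2 / (9 * (m : ℝ) ^ 2))) := by
    have hε2 : ε ^ 2 ≤ 1 := pow_le_one₀ hε0.le hε1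
    refine Real.logb_nonneg (by norm_num) ((one_le_div (by positivity)).2 ?_)
    rw [div_le_iff₀ (by positivity)]
    nlinarith
  set A := |K| * (7 + 2 * a) with hA
  have hA0 : 0 ≤ A := by positivity
  have htA : (t : ℝ) ≤ A * N := by
    rw [hA, mul_assoc]
    exact ht.trans ((mul_le_mul_of_nonneg_right (le_abs_self K) hlog0).trans
      (mul_le_mul_of_nonneg_left hlog (abs_nonneg K)))
  have hlogr : Real.log ((n : ℝ) ^ γ) = γ * (N * Real.log 2) := by
    rw [Real.log_rpow hn0, hN, Real.logb, div_mul_cancel₀ _ (Real.log_pos (by norm_num)).ne']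
  have hl2 : 1 / 2 ≤ Real.log 2 := by have := Real.log_two_gt_d9; linarith
  have hceil : (⌈(t : ℝ) / Real.log ((n : ℝ) ^ γ)⌉₊ : ℝ) ≤ (2 * A + 1) * (1 / γ) := by
    have h1 : (t : ℝ) / Real.log ((n : ℝ) ^ γ) ≤ 2 * A * (1 / γ) := by
      rw [hlogr, div_le_iff₀ (by positivity)]
      refine htA.trans ?_
      have : 2 * A * (1 / γ) * (γ * (N * Real.log 2)) = A * N * (2 * Real.log 2) := by
        field_simp
      rw [this]
      exact le_mul_of_one_le_right (by positivity) (by linarith)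
    have h2 := Nat.ceil_lt_add_one (a := (t : ℝ) / Real.log ((n : ℝ) ^ γ))
      (by rw [hlogr]; positivity)
    have h3 : 1 ≤ 1 / γ := by rw [le_div_iff₀ hγ]; linarith
    linarith
  rw [rrvSeedLength]
  push_cast
  refine (mul_le_mul htA hceil (Nat.cast_nonneg _) (by positivity)).trans (le_of_eq ?_)
  ring

lemma tendsto_log_div_rpow {γ : ℝ} (hγ : 0 < γ) (A B : ℝ) :
    Filter.Tendsto (fun n : ℕ => (A * Real.logb 2 n + B) / (n : ℝ) ^ γ) Filter.atTop (𝓝 0) := by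
  have h1 : Filter.Tendsto (fun x : ℝ => Real.log x / x ^ γ) Filter.atTop (𝓝 0) :=
    (isLittleO_log_rpow_atTop hγ).tendsto_div_nhds_zero
  have h2 : Filter.Tendsto (fun x : ℝ => (x ^ γ)⁻¹) Filter.atTop (𝓝 0) :=
    (tendsto_rpow_atTop hγ).inv_tendsto_atTop
  have h3 := ((h1.const_mul (A / Real.log 2)).add (h2.const_mul B)).comp
    tendsto_natCast_atTop_atTop
  simp only [mul_zero, add_zero] at h3
  refine h3.congr fun n => ?_
  simp only [Function.comp, Real.logb]
  ring

/-- The threshold for the min-entropy is at most `n ^ α`. -/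
lemma threshold_le {n m : ℕ} {a α γ ε : ℝ} (hn : 2 ≤ n) (hm : 1 ≤ m) (ha : 0 < a)
    (hγ : 0 < γ) (hα : α ≤ 1) (hε : (n : ℝ) ^ (-a) ≤ ε)
    (hmn : (m : ℝ) ≤ (n : ℝ) ^ (α - γ) -
      ((8 + 8 * a) * Real.logb 2 n + 20) / (n : ℝ) ^ γ) :
    (n : ℝ) ^ γ * m + 8 * Real.logb 2 m + 8 * Real.logb 2 (1 / ε) + 20 ≤ (n : ℝ) ^ α := by
  have hn2 : (2 : ℝ) ≤ n := by exact_mod_cast hn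
  have hn0 : (0 : ℝ) < n := by linarith
  have hm0 : (1 : ℝ) ≤ m := by exact_mod_cast hm
  have hε0 : 0 < ε := (Real.rpow_pos_of_pos hn0 _).trans_le hε
  have hN0 : 0 ≤ Real.logb 2 n := Real.logb_nonneg (by norm_num) (by linarith)
  have hp : 0 < (n : ℝ) ^ γ := Real.rpow_pos_of_pos hn0 _
  have hlogε : -a * Real.logb 2 n ≤ Real.logb 2 ε := by
    rw [← Real.logb_rpow_eq_mul_logb_of_pos hn0]
    exact Real.logb_le_logb_of_le (by norm_num) (Real.rpow_pos_of_pos hn0 _) hε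
  have hmn' : (m : ℝ) ≤ n := by
    have h1 : 0 ≤ ((8 + 8 * a) * Real.logb 2 n + 20) / (n : ℝ) ^ γ := by positivity
    have h2 : (n : ℝ) ^ (α - γ) ≤ (n : ℝ) ^ (1 : ℝ) :=
      Real.rpow_le_rpow_of_exponent_le (by linarith) (by linarith)
    rw [Real.rpow_one] at h2
    linarith
  have hlogm : Real.logb 2 m ≤ Real.logb 2 n :=
    Real.logb_le_logb_of_le (by norm_num) (by linarith) hmn'
  have h := mul_le_mul_of_nonneg_left hmn hp.le
  rw [mul_sub, mul_div_cancel₀ _ hp.ne', ← Real.rpow_add hn0, add_sub_cancel] at h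
  rw [one_div, Real.logb_inv]
  linarith

end QuantumExtractor

open QuantumExtractor
theorem mainTheorem5 :
    -- code-based one-bit extractors with seed length `O(log (n/δ))` exist
    (∃ (K : ℝ) (t : ℕ → ℝ → ℕ) (C : (n : ℕ) → (δ : ℝ) → Bits n → Bits (t n δ) → Bool),
      IsCodeExtractorFamily K t C) ∧
    -- `c₀` is the `O(1)` of the min-entropy threshold
    ∃ c₀ : ℝ,
      ∀ (K : ℝ) (t : ℕ → ℝ → ℕ) (C : (n : ℕ) → (δ : ℝ) → Bits n → Bits (t n δ) → Bool),
      IsCodeExtractorFamily K t C →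
      -- `a` is the exponent in `ε = poly(1/n)`, and `D` the constant of the seed length
      ∀ a : ℝ, 0 < a → ∃ D : ℝ,
      ∀ α γ : ℝ, 0 < γ → γ < α → α ≤ 1 →
      ∃ η : ℕ → ℝ, Filter.Tendsto η Filter.atTop (𝓝 0) ∧
      ∀ (n m : ℕ) (ε : ℝ), 2 ≤ n → 1 ≤ m → (n : ℝ) ^ (-a) ≤ ε → ε ≤ 1 →
      ∀ (δ r k : ℝ) (d : ℕ),
        δ = ε ^ 2 / (9 * (m : ℝ) ^ 2) →
        r = (n : ℝ) ^ γ →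
        d = rrvSeedLength (t n δ) r →
        k = (n : ℝ) ^ γ * m + 8 * Real.logb 2 m + 8 * Real.logb 2 (1 / ε) + c₀ →
        -- the weak design exists
        (∃ S : Fin m → Finset (Fin d), IsWeakDesign (t n δ) r S) ∧
        -- the extractor property
        (∀ (S : Fin m → Finset (Fin d)) (hS : IsWeakDesign (t n δ) r S),
          IsQuantumProofStrongExtractor (trevisan (C n δ) S hS.1) k ε) ∧
        -- the seed length
        ((m : ℝ) ≤ (n : ℝ) ^ (α - γ) → (d : ℝ) ≤ D * (1 / γ * Real.logb 2 n)) ∧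
        -- the output length for a source with min-entropy `n ^ α`
        ((m : ℝ) ≤ (n : ℝ) ^ (α - γ) - η n →
          k ≤ (n : ℝ) ^ α ∧
          ∀ (S : Fin m → Finset (Fin d)) (hS : IsWeakDesign (t n δ) r S),
            IsQuantumProofStrongExtractor (trevisan (C n δ) S hS.1) ((n : ℝ) ^ α) ε) := by
  -- `η n` is what the terms `8 log m + 8 log (1/ε) + 20` can amount to when `m ≤ n` and `ε ≥ n ^
  -- (-a)`, divided by the factor `n ^ γ` that multiplies `m` in `k`.
  refine ⟨exists_isCodeExtractorFamily, 20, fun K t C hfam a ha =>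
    ⟨(|K| * (7 + 2 * a)) ^ 2 * 2 + |K| * (7 + 2 * a), fun α γ hγ hγα hα =>
    ⟨fun n => ((8 + 8 * a) * Real.logb 2 n + 20) / (n : ℝ) ^ γ, tendsto_log_div_rpow hγ _ _, ?_⟩⟩⟩
  intro n m ε hn hm hε hε1 δ r k d hδ hr hd hk
  have hn2 : (2 : ℝ) ≤ n := by exact_mod_cast hn
  have hm0 : (1 : ℝ) ≤ m := by exact_mod_cast hm
  have hε0 : 0 < ε := (Real.rpow_pos_of_pos (by linarith) _).trans_le hε
  have hδ0 : 0 < δ := by rw [hδ]; positivity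
  have hδ1 : δ ≤ 1 := by
    rw [hδ, div_le_one (by positivity)]
    nlinarith
  have hr1 : 1 < r := by rw [hr]; exact Real.one_lt_rpow (by linarith) hγ
  obtain ⟨hC, ht⟩ := hfam n (by omega) δ hδ0 hδ1
  have hext : ∀ (S : Fin m → Finset (Fin d)) (hS : IsWeakDesign (t n δ) r S),
      IsQuantumProofStrongExtractor (trevisan (C n δ) S hS.1) k ε := by
    intro S hS
    rw [hk, ← hr]
    exact isQuantumProofStrongExtractor_trevisan hm hε0 hε1 hδ hC hS
  refine ⟨?_, hext, ?_, ?_⟩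
  · rw [hd]
    exact exists_isWeakDesign _ _ hr1
  · intro hmn
    have hmn' : (m : ℝ) ≤ n := by
      refine hmn.trans ?_
      have := Real.rpow_le_rpow_of_exponent_le (by linarith : (1 : ℝ) ≤ n)
        (by linarith : α - γ ≤ 1)
      rwa [Real.rpow_one] at this
    rw [hd, hr]
    exact rrvSeedLength_le hn hm ha hγ (by linarith) hε hε1 hmn' (by rwa [← hδ])
  · intro hmn
    have hkα : k ≤ (n : ℝ) ^ α := by
      rw [hk]
      exact threshold_le hn hm ha hγ hα hε hmn
    exact ⟨hkα, fun S hS => (hext S hS).mono hkα⟩
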